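/- Theorem 2. Let $(\mathcal X,\Delta)$ be a metric space equipped with a probability measure $\mu$, and let $f^*:\mathcal X\to[K]=\{1,\dots,K\}$ be a ground-truth labelling. Let $\nu_d$ be the standard Gaussian measure on $\mathbb R^d$ with its Euclidean norm, and suppose that $\mu=\sum_{i=1}^K p_i\,\mu_i$, where $\mu_i=(g_i)_*\nu_d$ for maps $g_i:\mathbb R^d\to\mathcal X$, $p_i\in[0,1]$ and $\sum_i p_i=1$. Write $\mathcal B(\cdot,\rho)$ for closed balls of radius $\rho$. For a classifier $f:\mathcal X\to[K]$, a probability measure $\lambda$ on $\mathcal X$ and $\epsilon>0$ put $$\mathrm{Risk}_\lambda(f)=\Pr_{x\sim\lambda}[f(x)\ne f^*(x)],\qquad \mathrm{AdvRisk}^\epsilon_\mu(f)=\Pr_{x\sim\mu}\big[\exists\,x'\in\mathcal B(x,\epsilon):\ f(x')\neq f^*(x')\big],$$ and for a class $\mathcal F$ of classifiers let $\mathrm{Rob}^\epsilon_\mu(\mathcal F)=1-\inf_{f\in\mathcal F}\mathrm{AdvRisk}^\epsilon_\mu(f)$ be its intrinsic robustness (with $\inf\emptyset=+\infty$). Let $\epsilon>0$,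 $r>0$, $\delta\in(0,1]$ and, for $i\in[K]$, let $L_i(r)$ be constants such that $r\,L_i(r)\ge\epsilon$ and $$\Pr_{z\sim\nu_d}\big[\forall z'\in\mathcal B(z,r):\ \Delta(g_i(z'),g_i(z))\le L_i(r)\,\|z'-z\|_2\big]\ \ge\ 1-\delta .$$ Let $L_{\max}(r)=\max_i L_i(r)$ and $\alpha>0$. Let $\Phi$ be the distribution function of $\mathcal N(0,1)$ and $\Phi^{-1}$ its inverse, with $\Phi(\pm\infty)$ and $\Phi^{-1}(0)=-\infty$, $\Phi^{-1}(1)=+\infty$ understood as limits. (i) Let $\mathcal F_\alpha=\{f:\mathrm{Risk}_\mu(f)\ge\alpha\}$. If $p_i>0$ and $\alpha/p_i\le 1$ for every $i\in[K]$, then $$\mathrm{Rob}^\epsilon_\mu(\mathcal F_\alpha)\ \le\ 1+\delta-\min_{i\in[K]}\Big\{p_i\,\Phi\Big(\Phi^{-1}\Big(\frac{\alpha}{p_i}\Big)+\frac{\epsilon}{L_{\max}(r)}\Big)\Big\}.$$ (ii) Let $\tilde{\mathcal F}_\alpha=\{f:\mathrm{Risk}_{\mu_i}(f)\ge\alpha\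 \text{for all } i\in[K]\}$. Then $$\mathrm{Rob}^\epsilon_\mu(\tilde{\mathcal F}_\alpha)\ \le\ 1+\delta-\sum_{i=1}^K p_i\,\Phi\Big(\Phi^{-1}(\alpha)+\frac{\epsilon}{L_{\max}(r)}\Big).$$ (If $\alpha>1$ the class in (ii) is empty and the bound is trivial.) -/

import Mathlib

open MeasureTheory ProbabilityTheory

noncomputable section

namespace IntrinsicRobustness

/-- The distribution function `Φ` of the standard normal law on the line, extended to
`[-∞, +∞]` by `Φ(-∞) = 0` and `Φ(+∞) = 1`. -/
def gaussCDF (x : EReal) : ℝ :=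
  (gaussianReal 0 1).real {u : ℝ | (u : EReal) ≤ x}

/-- The inverse `Φ⁻¹ : [0, 1] → [-∞, +∞]` of `Φ`, with `Φ⁻¹(0) = -∞` and `Φ⁻¹(1) = +∞`. -/
def gaussQuantile (a : ℝ) : EReal :=
  sInf {x : EReal | a ≤ gaussCDF x}

/-- The standard Gaussian law `ν_d` on `ℝ^d` with the Euclidean norm. -/
abbrev latentLaw (d : ℕ) : Measure (EuclideanSpace ℝ (Fin d)) :=
  stdGaussian (EuclideanSpace ℝ (Fin d))

/-- `Risk_μ(f) = Pr_{x ∼ μ} [f(x) ≠ f*(x)]`. -/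
def risk {X : Type*} [MeasurableSpace X] {K : ℕ} (μ : Measure X) (fstar f : X → Fin K) : ℝ :=
  μ.real {x | f x ≠ fstar x}

/-- `AdvRisk_μ^ε(f) = Pr_{x ∼ μ} [∃ x' ∈ B(x, ε), f(x') ≠ f*(x')]`, with closed balls. -/
def advRisk {X : Type*} [MetricSpace X] [MeasurableSpace X] {K : ℕ}
    (μ : Measure X) (fstar : X → Fin K) (ε : ℝ) (f : X → Fin K) : ℝ :=
  μ.real {x | ∃ x' ∈ Metric.closedBall x ε, f x' ≠ fstar x'}

/-- Intrinsic robustness `1 - inf_{f ∈ F} AdvRisk_μ^ε(f)` of a class `F` of classifiers.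
It is extended-real valued only to give the infimum over an empty class its usual value `+∞`. -/
def intrinsicRob {X : Type*} [MetricSpace X] [MeasurableSpace X] {K : ℕ}
    (μ : Measure X) (fstar : X → Fin K) (ε : ℝ) (F : Set (X → Fin K)) : EReal :=
  1 - ⨅ f ∈ F, (advRisk μ fstar ε f : EReal)

/-- The (measurable) classifiers of risk at least `α`. -/
def imperfect {X : Type*} [MeasurableSpace X] {K : ℕ}
    (μ : Measure X) (fstar : X → Fin K) (α : ℝ) : Set (X → Fin K) :=
  {f | Measurable f ∧ α ≤ risk μ fstar f}

/-- The conditional law `μ_i = (g_i)_* ν_d` of the images generated by `g_i`. -/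
def condLaw {X : Type*} [MeasurableSpace X] {d : ℕ}
    (g : EuclideanSpace ℝ (Fin d) → X) : Measure X :=
  (latentLaw d).map g

/-- The (measurable) classifiers whose conditional risk is at least `α` for every class. -/
def classwiseImperfect {X : Type*} [MeasurableSpace X] {K d : ℕ}
    (g : Fin K → EuclideanSpace ℝ (Fin d) → X) (fstar : X → Fin K) (α : ℝ) :
    Set (X → Fin K) :=
  {f | Measurable f ∧ ∀ i, α ≤ risk (condLaw (g i)) fstar f}

/-- `μ` is generated by the conditional generative model `{(g_i, p_i)}`:
`μ = ∑ i, p_i · (g_i)_* ν_d`. -/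
structure IsGeneratedBy {X : Type*} [MeasurableSpace X] {K d : ℕ} (μ : Measure X)
    (g : Fin K → EuclideanSpace ℝ (Fin d) → X) (p : Fin K → ℝ) : Prop where
  measurable : ∀ i, Measurable (g i)
  nonneg : ∀ i, 0 ≤ p i
  sum_eq_one : ∑ i, p i = 1
  eq_mixture : μ = ∑ i, ENNReal.ofReal (p i) • condLaw (g i)

/-- `g` is `L`-locally Lipschitz at scale `r` with probability at least `1 - δ`. -/
def LocallyLipschitzWithProb {X : Type*} [MetricSpace X] {d : ℕ}
    (g : EuclideanSpace ℝ (Fin d) → X) (r L δ : ℝ) : Prop :=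
  1 - δ ≤ (latentLaw d).real
    {z | ∀ z' ∈ Metric.closedBall z r, dist (g z') (g z) ≤ L * ‖z' - z‖}

end IntrinsicRobustness

end

/-!
Pull the error set of a classifier back to the latent space. The Gaussian isoperimetric inequality
`G_t(ν A) ≤ ν (A_t)`, where `G_t(a) = Φ(Φ⁻¹(a) + t)` and `A_t` is the `t`-neighbourhood of `A`,
bounds the mass of the neighbourhoods of the pulled-back set from below, and on a set of latent
mass at least `1 - δ` the Lipschitz property carries the `ε / L`-neighbourhood of this set into the
`ε`-neighbourhood of the error set. Averaging over the classes gives (ii); for (i), `G_t` is concave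
with `0 ≤ G_t(0)`, so the weighted sum is smallest when one class carries the whole error.

The isoperimetric inequality comes from the heat semigroup `P_σ f(x) = ∫ f(x + σ y) dν(y)`. A
second-order expansion of `G_c` shows that `G_{c/√(1+h²)}(P_{√(1+h²)} f) ≤ P_h(G_c(P_1 f))` up to
an error `O(h³)`: the drift `G_c` loses between the two scales is paid for by its concavity, because
the gradient of `P_1 f` is at most `φ(Φ⁻¹(P_1 f))`, by the bathtub principle. Composing `n` such
steps with `n h²` bounded removes the error and yields
`G_t(∫ f) ≤ ∫ G_{tb}(P_{1/b} f(√(1 - b⁻²) y)) dν(y)` for every `b ≥ 1`. For the indicator of `A`,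
the integrand tends to `0` outside each `ρ`-neighbourhood of `A` with `ρ > t` as `b → ∞`.
-/

noncomputable section

namespace IntrinsicRobustness

open Filter Set Topology
open scoped NNReal RealInnerProductSpace

/-! ### Taylor bounds with Lipschitz derivatives -/

lemma abs_sub_sub_deriv_mul_le {s : Set ℝ} (hs : Convex ℝ s) {f f' : ℝ → ℝ} {A : ℝ≥0}
    (hf : ∀ x ∈ s, HasDerivAt f (f' x) x) (hf' : LipschitzOnWith A f' s) {a b : ℝ}
    (ha : a ∈ s) (hb : b ∈ s) :
    |f b - f a - f' a * (b - a)| ≤ A * |b - a| ^ 2 := by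
  have hsub : uIcc a b ⊆ s := hs.ordConnected.uIcc_subset ha hb
  have hderiv : ∀ t ∈ uIcc a b,
      HasDerivWithinAt (fun t ↦ f t - f' a * t) (f' t - f' a * 1) (uIcc a b) t := fun t ht ↦
    ((hf t (hsub ht)).sub ((hasDerivAt_id t).const_mul _)).hasDerivWithinAt
  have hbound : ∀ t ∈ uIcc a b, ‖f' t - f' a * 1‖ ≤ A * |b - a| := fun t ht ↦ by
    rw [mul_one]
    exact (hf'.norm_sub_le (hsub ht) ha).trans
      (mul_le_mul_of_nonneg_left (abs_sub_left_of_mem_uIcc ht) A.2)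
  have hdiff := (convex_uIcc a b).norm_image_sub_le_of_norm_hasDerivWithin_le hderiv hbound
    left_mem_uIcc right_mem_uIcc
  calc |f b - f a - f' a * (b - a)| = |f b - f' a * b - (f a - f' a * a)| := by ring_nf
    _ ≤ A * |b - a| * |b - a| := hdiff
    _ = A * |b - a| ^ 2 := by ring

lemma taylor_two_sub_cube_le {s : Set ℝ} (hs : Convex ℝ s) {f f' f'' : ℝ → ℝ} {A : ℝ≥0}
    (hf : ∀ x ∈ s, HasDerivAt f (f' x) x) (hf' : ∀ x ∈ s, HasDerivAt f' (f'' x) x)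
    (hf'' : LipschitzOnWith A f'' s) {a b : ℝ} (ha : a ∈ s) (hb : b ∈ s) :
    f a + f' a * (b - a) + f'' a / 2 * (b - a) ^ 2 - A * |b - a| ^ 3 ≤ f b := by
  have hsub : uIcc a b ⊆ s := hs.ordConnected.uIcc_subset ha hb
  have hderiv : ∀ t ∈ uIcc a b,
      HasDerivWithinAt (fun t ↦ f t - f' a * t - f'' a / 2 * (t - a) ^ 2)
        (f' t - f' a - f'' a * (t - a)) (uIcc a b) t := fun t ht ↦ by
    refine (((hf t (hsub ht)).sub ((hasDerivAt_id t).const_mul _)).sub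
      ((((hasDerivAt_id t).sub_const a).pow 2).const_mul _)).hasDerivWithinAt.congr_deriv ?_
    simp only [Nat.cast_ofNat, id_eq]
    ring
  have hbound : ∀ t ∈ uIcc a b, ‖f' t - f' a - f'' a * (t - a)‖ ≤ A * |b - a| ^ 2 := fun t ht ↦
    (abs_sub_sub_deriv_mul_le hs hf' hf'' ha (hsub ht)).trans <|
      mul_le_mul_of_nonneg_left
        (pow_le_pow_left₀ (abs_nonneg _) (abs_sub_left_of_mem_uIcc ht) 2) A.2
  have hdiff := (convex_uIcc a b).norm_image_sub_le_of_norm_hasDerivWithin_le hderiv hbound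
    left_mem_uIcc right_mem_uIcc
  rw [Real.norm_eq_abs, Real.norm_eq_abs] at hdiff
  have hlower := (abs_le.1 hdiff).1
  simp only [sub_self] at hlower
  nlinarith [hlower]

/-! ### The normal distribution function and its inverse -/

/-- The standard normal density `φ = Φ'`. -/
abbrev gaussPDF (x : ℝ) : ℝ := gaussianPDFReal 0 1 x

lemma gaussPDF_eq (x : ℝ) : gaussPDF x = (√(2 * Real.pi))⁻¹ * Real.exp (-x ^ 2 / 2) := by
  simp [gaussPDF, gaussianPDFReal]

lemma gaussPDF_pos (x : ℝ) : 0 < gaussPDF x := gaussianPDFReal_pos 0 1 x one_ne_zero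

lemma inv_sqrt_two_pi_le_one : (√(2 * Real.pi))⁻¹ ≤ 1 :=
  inv_le_one_of_one_le₀ <| Real.one_le_sqrt.2 <| by linarith [Real.pi_gt_three]

lemma gaussPDF_le_one (x : ℝ) : gaussPDF x ≤ 1 := by
  rw [gaussPDF_eq]
  refine mul_le_one₀ inv_sqrt_two_pi_le_one (Real.exp_pos _).le (Real.exp_le_one_iff.2 ?_)
  linarith [sq_nonneg x]

lemma continuous_gaussPDF : Continuous gaussPDF := by
  rw [show gaussPDF = _ from funext gaussPDF_eq]
  fun_prop

lemma hasDerivAt_gaussPDF (x : ℝ) : HasDerivAt gaussPDF (-x * gaussPDF x) x := by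
  have h := (((hasDerivAt_pow 2 x).neg.div_const 2).exp).const_mul ((√(2 * Real.pi))⁻¹)
  rw [show gaussPDF = _ from funext gaussPDF_eq]
  refine h.congr_deriv ?_
  simp only [Pi.neg_apply]
  ring

lemma gaussPDF_add (w c : ℝ) :
    gaussPDF (w + c) = gaussPDF w * Real.exp (-c * w - c ^ 2 / 2) := by
  rw [gaussPDF_eq, gaussPDF_eq, mul_assoc, ← Real.exp_add]
  congr 2
  ring

lemma abs_mul_gaussPDF_le_one (x : ℝ) : |x * gaussPDF x| ≤ 1 := by
  have hexp : |x| ≤ Real.exp (x ^ 2 / 2) := by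
    have := Real.add_one_le_exp (x ^ 2 / 2)
    nlinarith [sq_abs x, sq_nonneg (|x| - 1)]
  have hprod : |x| * Real.exp (-x ^ 2 / 2) ≤ 1 := by
    rw [neg_div, Real.exp_neg, ← div_eq_mul_inv, div_le_one (Real.exp_pos _)]
    exact hexp
  rw [abs_mul, abs_of_pos (gaussPDF_pos x), gaussPDF_eq, mul_left_comm]
  exact mul_le_one₀ inv_sqrt_two_pi_le_one (by positivity) hprod

lemma lipschitzWith_gaussPDF : LipschitzWith 1 gaussPDF := by
  refine lipschitzWith_of_nnnorm_deriv_le (fun x ↦ (hasDerivAt_gaussPDF x).differentiableAt)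
    fun x ↦ ?_
  rw [(hasDerivAt_gaussPDF x).deriv, neg_mul, nnnorm_neg]
  exact abs_mul_gaussPDF_le_one x

lemma gaussCDF_coe (x : ℝ) : gaussCDF x = (gaussianReal 0 1).real (Iic x) := by
  simp [gaussCDF, Iic]

@[simp] lemma gaussCDF_bot : gaussCDF ⊥ = 0 := by simp [gaussCDF]

@[simp] lemma gaussCDF_top : gaussCDF ⊤ = 1 := by simp [gaussCDF]

lemma gaussCDF_nonneg (x : EReal) : 0 ≤ gaussCDF x := measureReal_nonneg

lemma gaussCDF_le_one (x : EReal) : gaussCDF x ≤ 1 := measureReal_le_one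

lemma gaussCDF_mono : Monotone gaussCDF := fun _ _ h ↦
  measureReal_mono fun _ hu ↦ le_trans hu h

lemma gaussCDF_eq_integral (x : ℝ) : gaussCDF x = ∫ u in Iic x, gaussPDF u := by
  rw [gaussCDF_coe, measureReal_def, gaussianReal_apply_eq_integral 0 one_ne_zero,
    ENNReal.toReal_ofReal]
  exact integral_nonneg fun u ↦ (gaussPDF_pos u).le

lemma hasDerivAt_gaussCDF (x : ℝ) : HasDerivAt (fun y : ℝ ↦ gaussCDF y) (gaussPDF x) x := by
  have hftc := intervalIntegral.integral_hasDerivAt_right (a := 0) (b := x) (f := gaussPDF)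
    (continuous_gaussPDF.intervalIntegrable _ _)
    (continuous_gaussPDF.stronglyMeasurableAtFilter _ _) continuous_gaussPDF.continuousAt
  have hint (s : Set ℝ) : IntegrableOn gaussPDF s :=
    (integrable_gaussianPDFReal 0 1).integrableOn
  have hsub (y : ℝ) : gaussCDF y = gaussCDF (0 : ℝ) + ∫ u in (0 : ℝ)..y, gaussPDF u := by
    rw [gaussCDF_eq_integral, gaussCDF_eq_integral,
      ← intervalIntegral.integral_Iic_sub_Iic (hint _) (hint _), add_sub_cancel]
  exact (hftc.const_add _).congr_of_eventuallyEq (.of_forall hsub)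

lemma gaussCDF_le_taylor_one (x y : ℝ) :
    gaussCDF y ≤ gaussCDF x + gaussPDF x * (y - x) + (y - x) ^ 2 := by
  have h := abs_sub_sub_deriv_mul_le (convex_univ (𝕜 := ℝ)) (f := fun y : ℝ ↦ gaussCDF y)
    (fun x _ ↦ hasDerivAt_gaussCDF x) lipschitzWith_gaussPDF.lipschitzOnWith
    (mem_univ x) (mem_univ y)
  rw [NNReal.coe_one, one_mul, sq_abs] at h
  linarith [(abs_le.1 h).2]

lemma strictMono_gaussCDF_coe : StrictMono fun y : ℝ ↦ gaussCDF y :=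
  strictMono_of_deriv_pos fun x ↦ by
    rw [(hasDerivAt_gaussCDF x).deriv]
    exact gaussPDF_pos x

lemma continuous_gaussCDF_coe : Continuous fun y : ℝ ↦ gaussCDF y :=
  continuous_iff_continuousAt.2 fun x ↦ (hasDerivAt_gaussCDF x).continuousAt

lemma gaussCDF_eq_cdf (x : ℝ) : gaussCDF x = cdf (gaussianReal 0 1) x := by
  rw [gaussCDF_coe, cdf_eq_real]

lemma tendsto_gaussCDF_atBot : Tendsto (fun y : ℝ ↦ gaussCDF y) atBot (𝓝 0) := by
  simp_rw [gaussCDF_eq_cdf]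
  exact tendsto_cdf_atBot _

lemma tendsto_gaussCDF_atTop : Tendsto (fun y : ℝ ↦ gaussCDF y) atTop (𝓝 1) := by
  simp_rw [gaussCDF_eq_cdf]
  exact tendsto_cdf_atTop _

lemma gaussCDF_coe_mem_Ioo (x : ℝ) : gaussCDF x ∈ Ioo 0 1 :=
  ⟨(gaussCDF_nonneg _).trans_lt (strictMono_gaussCDF_coe (sub_one_lt x)),
    (strictMono_gaussCDF_coe (lt_add_one x)).trans_le (gaussCDF_le_one _)⟩

lemma exists_gaussCDF_coe_eq {a : ℝ} (ha : a ∈ Ioo 0 1) : ∃ x : ℝ, gaussCDF x = a :=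
  mem_range_of_exists_le_of_exists_ge continuous_gaussCDF_coe
    (((tendsto_gaussCDF_atBot.eventually_lt_const ha.1).exists).imp fun _ h ↦ h.le)
    (((tendsto_gaussCDF_atTop.eventually_const_lt ha.2).exists).imp fun _ h ↦ h.le)

lemma exists_gaussCDF_eq {a : ℝ} (ha : a ∈ Icc 0 1) : ∃ x : EReal, gaussCDF x = a := by
  rcases ha.1.eq_or_lt with rfl | h0
  · exact ⟨⊥, gaussCDF_bot⟩
  rcases ha.2.eq_or_lt with rfl | h1
  · exact ⟨⊤, gaussCDF_top⟩
  obtain ⟨x, hx⟩ := exists_gaussCDF_coe_eq ⟨h0, h1⟩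
  exact ⟨x, hx⟩

lemma strictMono_gaussCDF : StrictMono gaussCDF := by
  intro x y h
  induction x with
  | bot =>
    induction y with
    | bot => exact absurd h (lt_irrefl _)
    | coe y => simpa using (gaussCDF_coe_mem_Ioo y).1
    | top => simp
  | coe x =>
    induction y with
    | bot => exact absurd h not_lt_bot
    | coe y => exact strictMono_gaussCDF_coe (by exact_mod_cast h)
    | top => simpa using (gaussCDF_coe_mem_Ioo x).2
  | top => exact absurd h not_top_lt

lemma continuous_gaussCDF : Continuous gaussCDF := by
  let F : EReal → Icc (0 : ℝ) 1 := fun x ↦ ⟨gaussCDF x, gaussCDF_nonneg x, gaussCDF_le_one x⟩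
  have hsurj : Function.Surjective F := fun ⟨a, ha⟩ ↦
    (exists_gaussCDF_eq ha).imp fun _ hx ↦ Subtype.ext hx
  have hF : Continuous F := Monotone.continuous_of_surjective (fun _ _ h ↦ gaussCDF_mono h) hsurj
  exact (continuous_subtype_val.comp hF : Continuous fun x ↦ (F x : ℝ))

lemma gaussQuantile_gaussCDF (x : EReal) : gaussQuantile (gaussCDF x) = x := by
  simp_rw [gaussQuantile, strictMono_gaussCDF.le_iff_le]
  exact csInf_Ici

lemma gaussQuantile_of_nonpos {a : ℝ} (h : a ≤ 0) : gaussQuantile a = ⊥ :=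
  le_bot_iff.1 (sInf_le (by simpa using h))

lemma gaussQuantile_of_one_le {a : ℝ} (h : 1 ≤ a) : gaussQuantile a = ⊤ :=
  top_le_iff.1 <| le_sInf fun x (hx : a ≤ gaussCDF x) ↦
    strictMono_gaussCDF.le_iff_le.1 (gaussCDF_top.trans_le (h.trans hx))

lemma gaussQuantile_mono : Monotone gaussQuantile := fun _ _ h ↦
  sInf_le_sInf fun _ hx ↦ le_trans h hx

lemma continuous_gaussQuantile : Continuous gaussQuantile :=
  gaussQuantile_mono.continuous_of_surjective fun x ↦ ⟨_, gaussQuantile_gaussCDF x⟩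

/-! ### The Gaussian isoperimetric profile -/

/-- `Φ(Φ⁻¹(a) + c)`: the mass of the `c`-neighbourhood of a half-space of Gaussian mass `a`. -/
def gaussShift (c a : ℝ) : ℝ := gaussCDF (gaussQuantile a + (c : EReal))

lemma gaussShift_gaussCDF (c x : ℝ) :
    gaussShift c (gaussCDF x) = gaussCDF ((x + c : ℝ) : EReal) := by
  rw [gaussShift, gaussQuantile_gaussCDF, EReal.coe_add]

lemma gaussShift_of_nonpos (c : ℝ) {a : ℝ} (h : a ≤ 0) : gaussShift c a = 0 := by
  simp [gaussShift, gaussQuantile_of_nonpos h]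

lemma gaussShift_of_one_le (c : ℝ) {a : ℝ} (h : 1 ≤ a) : gaussShift c a = 1 := by
  simp [gaussShift, gaussQuantile_of_one_le h]

lemma gaussShift_mem_Icc (c a : ℝ) : gaussShift c a ∈ Icc 0 1 :=
  ⟨gaussCDF_nonneg _, gaussCDF_le_one _⟩

lemma gaussShift_mono (c : ℝ) : Monotone (gaussShift c) := fun _ _ h ↦
  gaussCDF_mono (add_le_add_left (gaussQuantile_mono h) _)

lemma continuous_gaussShift (c : ℝ) : Continuous (gaussShift c) := by
  refine continuous_gaussCDF.comp (continuous_iff_continuousAt.2 fun a ↦ ?_)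
  exact (EReal.continuousAt_add (Or.inr (EReal.coe_ne_bot c)) (Or.inr (EReal.coe_ne_top c))).comp
    (f := fun a ↦ (gaussQuantile a, (c : EReal)))
    (continuous_gaussQuantile.continuousAt.prodMk continuousAt_const)

lemma continuous_gaussShift_left (a : ℝ) : Continuous fun c ↦ gaussShift c a := by
  rcases le_or_gt a 0 with h0 | h0
  · simp_rw [gaussShift_of_nonpos _ h0]
    exact continuous_const
  rcases le_or_gt 1 a with h1 | h1
  · simp_rw [gaussShift_of_one_le _ h1]
    exact continuous_const
  obtain ⟨x, rfl⟩ := exists_gaussCDF_coe_eq ⟨h0, h1⟩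
  simp_rw [gaussShift_gaussCDF]
  exact continuous_gaussCDF_coe.comp (continuous_const.add continuous_id)

lemma gaussQuantile_toReal_gaussCDF (x : ℝ) : (gaussQuantile (gaussCDF x)).toReal = x := by
  rw [gaussQuantile_gaussCDF, EReal.toReal_coe]

lemma hasDerivAt_gaussQuantile (x : ℝ) :
    HasDerivAt (fun a ↦ (gaussQuantile a).toReal) (gaussPDF x)⁻¹ (gaussCDF x) := by
  refine HasDerivAt.of_local_left_inverse (f := fun y : ℝ ↦ gaussCDF y) ?_ ?_
    (gaussPDF_pos x).ne' ?_
  · have h : ContinuousAt EReal.toReal (gaussQuantile (gaussCDF x)) := by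
      rw [gaussQuantile_gaussCDF]
      exact EReal.tendsto_toReal (EReal.coe_ne_top x) (EReal.coe_ne_bot x)
    exact h.comp (f := gaussQuantile) continuous_gaussQuantile.continuousAt
  · simpa only [gaussQuantile_toReal_gaussCDF] using hasDerivAt_gaussCDF x
  · filter_upwards [isOpen_Ioo.mem_nhds (gaussCDF_coe_mem_Ioo x)] with a ha
    obtain ⟨y, rfl⟩ := exists_gaussCDF_coe_eq ha
    simp only [gaussQuantile_toReal_gaussCDF]

/-- The derivative of `gaussShift c` in the mass, in closed form. -/
def gaussShiftDeriv (c a : ℝ) : ℝ := Real.exp (-c * (gaussQuantile a).toReal - c ^ 2 / 2)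

/-- The second derivative of `gaussShift c` in the mass, in closed form. -/
def gaussShiftDeriv₂ (c a : ℝ) : ℝ :=
  -c * (gaussShiftDeriv c a * (gaussPDF (gaussQuantile a).toReal)⁻¹)

lemma gaussShiftDeriv_gaussCDF (c x : ℝ) :
    gaussShiftDeriv c (gaussCDF x) = Real.exp (-c * x - c ^ 2 / 2) := by
  rw [gaussShiftDeriv, gaussQuantile_toReal_gaussCDF]

lemma gaussShiftDeriv₂_gaussCDF (c x : ℝ) :
    gaussShiftDeriv₂ c (gaussCDF x) = -c * (Real.exp (-c * x - c ^ 2 / 2) * (gaussPDF x)⁻¹) := by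
  rw [gaussShiftDeriv₂, gaussShiftDeriv_gaussCDF, gaussQuantile_toReal_gaussCDF]

lemma hasDerivAt_gaussShift (c : ℝ) {a : ℝ} (ha : a ∈ Ioo 0 1) :
    HasDerivAt (gaussShift c) (gaussShiftDeriv c a) a := by
  obtain ⟨x, rfl⟩ := exists_gaussCDF_coe_eq ha
  have heq : gaussShift c =ᶠ[𝓝 (gaussCDF x)]
      fun a ↦ gaussCDF (((gaussQuantile a).toReal + c : ℝ) : EReal) := by
    filter_upwards [isOpen_Ioo.mem_nhds ha] with a ha
    obtain ⟨y, rfl⟩ := exists_gaussCDF_coe_eq ha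
    rw [gaussShift_gaussCDF, gaussQuantile_toReal_gaussCDF]
  refine HasDerivAt.congr_of_eventuallyEq ?_ heq
  have h := (hasDerivAt_gaussCDF (x + c)).comp_of_eq (gaussCDF x)
    ((hasDerivAt_gaussQuantile x).add_const c) (by rw [gaussQuantile_toReal_gaussCDF])
  refine h.congr_deriv ?_
  rw [gaussPDF_add, gaussShiftDeriv_gaussCDF]
  field_simp [(gaussPDF_pos x).ne']

lemma hasDerivAt_gaussShiftDeriv (c : ℝ) {a : ℝ} (ha : a ∈ Ioo 0 1) :
    HasDerivAt (gaussShiftDeriv c) (gaussShiftDeriv₂ c a) a := by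
  obtain ⟨x, rfl⟩ := exists_gaussCDF_coe_eq ha
  refine (((hasDerivAt_gaussQuantile x).const_mul (-c)).sub_const (c ^ 2 / 2)).exp.congr_deriv ?_
  rw [gaussShiftDeriv₂_gaussCDF, gaussQuantile_toReal_gaussCDF]
  ring

lemma hasDerivAt_gaussShiftDeriv₂ (c x : ℝ) :
    HasDerivAt (gaussShiftDeriv₂ c)
      (-c * (x - c) * Real.exp (-c * x - c ^ 2 / 2) * ((gaussPDF x)⁻¹) ^ 2) (gaussCDF x) := by
  have hpdf : gaussPDF x ≠ 0 := (gaussPDF_pos x).ne'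
  have hexp := hasDerivAt_gaussShiftDeriv c (gaussCDF_coe_mem_Ioo x)
  have hden := (hasDerivAt_gaussPDF x).comp_of_eq (gaussCDF x) (hasDerivAt_gaussQuantile x)
    (gaussQuantile_toReal_gaussCDF x).symm
  have hinv := hden.inv (by simpa only [Function.comp, gaussQuantile_toReal_gaussCDF] using hpdf)
  refine ((hexp.mul hinv).const_mul (-c)).congr_deriv ?_
  simp only [Pi.inv_apply, Function.comp_apply, gaussShiftDeriv₂_gaussCDF,
    gaussShiftDeriv_gaussCDF, gaussQuantile_toReal_gaussCDF]
  field_simp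
  ring

lemma concaveOn_gaussShift {c : ℝ} (hc : 0 ≤ c) : ConcaveOn ℝ (Icc 0 1) (gaussShift c) := by
  refine AntitoneOn.concaveOn_of_deriv (convex_Icc 0 1) (continuous_gaussShift c).continuousOn ?_ ?_
  · rw [interior_Icc]
    exact fun a ha ↦ (hasDerivAt_gaussShift c ha).differentiableAt.differentiableWithinAt
  · rw [interior_Icc]
    intro a ha b hb hab
    rw [(hasDerivAt_gaussShift c ha).deriv, (hasDerivAt_gaussShift c hb).deriv]
    obtain ⟨x, rfl⟩ := exists_gaussCDF_coe_eq ha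
    obtain ⟨y, rfl⟩ := exists_gaussCDF_coe_eq hb
    have hxy : x ≤ y := strictMono_gaussCDF_coe.le_iff_le.1 hab
    rw [gaussShiftDeriv_gaussCDF, gaussShiftDeriv_gaussCDF]
    exact Real.exp_le_exp.2 (by nlinarith)

lemma mul_gaussShift_le {c l a : ℝ} (hc : 0 ≤ c) (hl : l ∈ Icc (0 : ℝ) 1)
    (ha : a ∈ Icc (0 : ℝ) 1) : l * gaussShift c a ≤ gaussShift c (l * a) := by
  have h := (concaveOn_gaussShift hc).2 ha (left_mem_Icc.2 zero_le_one) hl.1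
    (sub_nonneg.2 hl.2) (add_sub_cancel _ _)
  simpa [gaussShift_of_nonpos] using h

lemma Icc_gaussCDF_subset_Ioo (x y : ℝ) : Icc (gaussCDF x) (gaussCDF y) ⊆ Ioo 0 1 :=
  Icc_subset_Ioo (gaussCDF_coe_mem_Ioo x).1 (gaussCDF_coe_mem_Ioo y).2

lemma exists_gaussCDF_eq_of_mem_Icc {x y a : ℝ} (ha : a ∈ Icc (gaussCDF x) (gaussCDF y)) :
    ∃ w ∈ Icc x y, gaussCDF w = a := by
  obtain ⟨w, rfl⟩ := exists_gaussCDF_coe_eq (Icc_gaussCDF_subset_Ioo x y ha)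
  exact ⟨w, ⟨strictMono_gaussCDF_coe.le_iff_le.1 ha.1, strictMono_gaussCDF_coe.le_iff_le.1 ha.2⟩,
    rfl⟩

lemma exists_lipschitzOnWith_gaussShiftDeriv₂ (C M : ℝ) : ∃ A : ℝ≥0, ∀ c ∈ Icc 0 C,
    LipschitzOnWith A (gaussShiftDeriv₂ c) (Icc (gaussCDF (-M : ℝ)) (gaussCDF M)) := by
  have hcont : Continuous fun p : ℝ × ℝ ↦
      -p.1 * (p.2 - p.1) * Real.exp (-p.1 * p.2 - p.1 ^ 2 / 2) * ((gaussPDF p.2)⁻¹) ^ 2 := by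
    have : Continuous fun p : ℝ × ℝ ↦ (gaussPDF p.2)⁻¹ :=
      (continuous_gaussPDF.comp continuous_snd).inv₀ fun p ↦ (gaussPDF_pos p.2).ne'
    fun_prop
  obtain ⟨A, hA⟩ := ((isCompact_Icc (a := (0 : ℝ)) (b := C)).prod
    (isCompact_Icc (a := -M) (b := M))).exists_bound_of_continuousOn hcont.continuousOn
  refine ⟨A.toNNReal, fun c hc ↦ (convex_Icc _ _).lipschitzOnWith_of_nnnorm_deriv_le ?_ ?_⟩
  · intro a ha
    obtain ⟨w, -, rfl⟩ := exists_gaussCDF_eq_of_mem_Icc ha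
    exact (hasDerivAt_gaussShiftDeriv₂ c w).differentiableAt
  · intro a ha
    obtain ⟨w, hw, rfl⟩ := exists_gaussCDF_eq_of_mem_Icc ha
    rw [(hasDerivAt_gaussShiftDeriv₂ c w).deriv, ← NNReal.coe_le_coe, coe_nnnorm]
    exact (hA (c, w) ⟨hc, hw⟩).trans (Real.le_coe_toNNReal A)

lemma exists_gaussShift_taylor_two (C M : ℝ) : ∃ A : ℝ≥0, ∀ c ∈ Icc 0 C,
    ∀ a ∈ Icc (gaussCDF (-M : ℝ)) (gaussCDF M), ∀ b ∈ Icc (gaussCDF (-M : ℝ)) (gaussCDF M),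
    gaussShift c a + gaussShiftDeriv c a * (b - a) + gaussShiftDeriv₂ c a / 2 * (b - a) ^ 2
      - A * |b - a| ^ 3 ≤ gaussShift c b := by
  obtain ⟨A, hA⟩ := exists_lipschitzOnWith_gaussShiftDeriv₂ C M
  have hsub := Icc_gaussCDF_subset_Ioo (-M) M
  exact ⟨A, fun c hc a ha b hb ↦ taylor_two_sub_cube_le (convex_Icc _ _)
    (fun t ht ↦ hasDerivAt_gaussShift c (hsub ht))
    (fun t ht ↦ hasDerivAt_gaussShiftDeriv c (hsub ht)) (hA c hc) ha hb⟩

lemma gaussPDF_le_gaussPDF {x y : ℝ} (h : |x| ≤ |y|) : gaussPDF y ≤ gaussPDF x := by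
  rw [gaussPDF_eq, gaussPDF_eq]
  have := sq_le_sq.2 h
  gcongr

lemma exists_gaussPDF_sub_eq_neg_mul {x y : ℝ} (hxy : x < y) :
    ∃ u ∈ Ioo x y, gaussPDF y - gaussPDF x = -u * (gaussCDF y - gaussCDF x) := by
  obtain ⟨u, hu, heq⟩ := exists_ratio_hasDerivAt_eq_ratio_slope gaussPDF (fun u ↦ -u * gaussPDF u)
    hxy continuous_gaussPDF.continuousOn (fun u _ ↦ hasDerivAt_gaussPDF u)
    (fun u : ℝ ↦ gaussCDF u) gaussPDF continuous_gaussCDF_coe.continuousOn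
    fun u _ ↦ hasDerivAt_gaussCDF u
  refine ⟨u, hu, mul_right_cancel₀ (gaussPDF_pos u).ne' ?_⟩
  rw [← heq]
  ring

lemma abs_gaussPDF_sub_le {M x y : ℝ} (hx : x ∈ Icc (-M) M) (hy : y ∈ Icc (-M) M) :
    |gaussPDF y - gaussPDF x| ≤ M * |gaussCDF y - gaussCDF x| := by
  wlog hxy : x ≤ y generalizing x y
  · rw [abs_sub_comm, abs_sub_comm (gaussCDF _)]
    exact this hy hx (le_of_not_ge hxy)
  rcases hxy.eq_or_lt with rfl | hlt
  · simp
  obtain ⟨u, hu, heq⟩ := exists_gaussPDF_sub_eq_neg_mul hlt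
  rw [heq, abs_mul, abs_neg]
  gcongr
  exact abs_le.2 ⟨hx.1.trans hu.1.le, hu.2.le.trans hy.2⟩

lemma gaussShiftDeriv₂_gaussCDF_eq_div (c w : ℝ) :
    gaussShiftDeriv₂ c (gaussCDF w) = -(c * gaussPDF (w + c) / gaussPDF w ^ 2) := by
  have := (gaussPDF_pos w).ne'
  rw [gaussShiftDeriv₂_gaussCDF, gaussPDF_add]
  field_simp

lemma one_sub_one_div_sqrt_one_add_mem_Icc {t : ℝ} (ht : 0 ≤ t) :
    1 - 1 / √(1 + t) ∈ Icc (t / 2 - t ^ 2) t := by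
  have hsq : √(1 + t) ^ 2 = 1 + t := Real.sq_sqrt (by positivity)
  have hle : √(1 + t) ≤ 1 + t / 2 := Real.sqrt_one_add_le (by linarith)
  have hge : 1 ≤ √(1 + t) := Real.one_le_sqrt.2 (by linarith)
  have hdiv : 1 - 1 / √(1 + t) = t / (√(1 + t) + 1 + t) := by
    field_simp
    nlinarith
  rw [hdiv]
  constructor
  · rw [le_div_iff₀ (by positivity)]
    nlinarith [mul_nonneg ht ht, mul_nonneg (mul_nonneg ht ht) ht]
  · exact div_le_self ht (by linarith)

lemma gaussCDF_add_div_sqrt_le {c h : ℝ} (hc : 0 ≤ c) (hh : h ∈ Icc (0 : ℝ) 1) (w : ℝ) :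
    gaussCDF ((w + c / √(1 + h ^ 2) : ℝ) : EReal)
      ≤ gaussCDF ((w + c : ℝ) : EReal) - c * gaussPDF (w + c) * h ^ 2 / 2
        + (c + c ^ 2) * h ^ 3 := by
  set r := 1 - 1 / √(1 + h ^ 2) with hr
  obtain ⟨hr_ge, hr_le⟩ := one_sub_one_div_sqrt_one_add_mem_Icc (sq_nonneg h)
  have hpow : (h ^ 2) ^ 2 ≤ h ^ 3 := by
    rw [← pow_mul]
    exact pow_le_pow_of_le_one hh.1 hh.2 (by norm_num)
  have hr_nonneg : 0 ≤ r := sub_nonneg.2 <|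
    div_le_one_of_le₀ (Real.one_le_sqrt.2 (by linarith [sq_nonneg h])) (Real.sqrt_nonneg _)
  have hfirst : c * gaussPDF (w + c) * (h ^ 2 / 2 - r) ≤ c * h ^ 3 := by
    have hdiff : h ^ 2 / 2 - r ≤ h ^ 3 := by linarith
    have hcφ : c * gaussPDF (w + c) ≤ c := mul_le_of_le_one_right hc (gaussPDF_le_one _)
    have hcφ_nonneg := mul_nonneg hc (gaussPDF_pos (w + c)).le
    exact (mul_le_mul_of_nonneg_left hdiff hcφ_nonneg).trans
      (mul_le_mul_of_nonneg_right hcφ (pow_nonneg hh.1 3))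
  have hsecond : c ^ 2 * r ^ 2 ≤ c ^ 2 * h ^ 3 :=
    mul_le_mul_of_nonneg_left ((pow_le_pow_left₀ hr_nonneg hr_le 2).trans hpow) (sq_nonneg c)
  have htaylor := gaussCDF_le_taylor_one (w + c) (w + c / √(1 + h ^ 2))
  rw [show w + c / √(1 + h ^ 2) - (w + c) = -(c * r) by rw [hr]; ring] at htaylor
  linarith

lemma neg_sub_le_gaussShiftDeriv₂_mul {C M R S c t w : ℝ} (hc : c ∈ Icc 0 C) (hw : w ∈ Icc (-M) M)
    (hR : 0 ≤ R) (hS : S ≤ t * gaussPDF w ^ 2 + R) :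
    -(c * gaussPDF (w + c) * t / 2) - C / gaussPDF M ^ 2 / 2 * R
      ≤ gaussShiftDeriv₂ c (gaussCDF w) / 2 * S := by
  have hpos := gaussPDF_pos w
  have hpos_M := gaussPDF_pos M
  have hpos_add := gaussPDF_pos (w + c)
  have hle : gaussPDF M ≤ gaussPDF w :=
    gaussPDF_le_gaussPDF ((abs_le.2 hw).trans (le_abs_self M))
  have hcoef : c * gaussPDF (w + c) / gaussPDF w ^ 2 ≤ C / gaussPDF M ^ 2 := by
    gcongr
    · exact hc.1.trans hc.2
    · exact (mul_le_of_le_one_right hc.1 (gaussPDF_le_one _)).trans hc.2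
  have hcoef_nonneg : 0 ≤ c * gaussPDF (w + c) / gaussPDF w ^ 2 := by
    have := hc.1
    positivity
  have hcancel : c * gaussPDF (w + c) / gaussPDF w ^ 2 * (t * gaussPDF w ^ 2)
      = c * gaussPDF (w + c) * t := by
    field_simp
  have hS_mul := mul_le_mul_of_nonneg_left hS hcoef_nonneg
  have hR_mul := mul_le_mul_of_nonneg_right hcoef hR
  rw [gaussShiftDeriv₂_gaussCDF_eq_div]
  linarith

/-! ### Integrals of bounded functions -/

section BoundedIntegrals

variable {α : Type*} [MeasurableSpace α] {μ : Measure α} {f g : α → ℝ}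

lemma integrable_of_forall_mem_Icc [IsFiniteMeasure μ] (hf : Measurable f) {a b : ℝ}
    (h : ∀ x, f x ∈ Icc a b) : Integrable f μ :=
  Integrable.of_mem_Icc a b hf.aemeasurable (ae_of_all _ h)

lemma integral_mem_Icc_of_forall [IsProbabilityMeasure μ] (hf : Measurable f) {a b : ℝ}
    (h : ∀ x, f x ∈ Icc a b) : ∫ x, f x ∂μ ∈ Icc a b := by
  have hi := integrable_of_forall_mem_Icc (μ := μ) hf h
  constructor
  · simpa using integral_mono (integrable_const a) hi fun x ↦ (h x).1
  · simpa using integral_mono hi (integrable_const b) fun x ↦ (h x).2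

lemma norm_le_one_of_mem_Icc {a : ℝ} (ha : a ∈ Icc 0 1) : ‖a‖ ≤ 1 := by
  rw [Real.norm_eq_abs, abs_of_nonneg ha.1]
  exact ha.2

lemma integrable_mul_of_mem_Icc (hf : Measurable f) (h : ∀ x, f x ∈ Icc 0 1)
    (hg : Integrable g μ) : Integrable (fun x ↦ f x * g x) μ :=
  hg.bdd_mul hf.aestronglyMeasurable (ae_of_all _ fun x ↦ norm_le_one_of_mem_Icc (h x))

lemma sq_integral_le_integral_sq [IsProbabilityMeasure μ] (hg : MemLp g 2 μ) :
    (∫ x, g x ∂μ) ^ 2 ≤ ∫ x, g x ^ 2 ∂μ := by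
  have hvar := variance_nonneg g μ
  rw [variance_eq_sub hg] at hvar
  exact sub_nonneg.1 hvar

lemma integral_sub_integral_sq_le [IsProbabilityMeasure μ] (hg : AEMeasurable g μ) (a : ℝ) :
    ∫ x, (g x - ∫ y, g y ∂μ) ^ 2 ∂μ ≤ ∫ x, (g x - a) ^ 2 ∂μ := by
  rw [← variance_eq_integral hg, ← variance_sub_const hg.aestronglyMeasurable a]
  exact variance_le_expectation_sq (hg.sub_const a).aestronglyMeasurable

lemma sq_integral_mul_le [IsProbabilityMeasure μ] (hf : Measurable f) (h : ∀ x, f x ∈ Icc 0 1)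
    (hg : MemLp g 2 μ) : (∫ x, f x * g x ∂μ) ^ 2 ≤ ∫ x, g x ^ 2 ∂μ := by
  have hle (x : α) : ‖f x * g x‖ ≤ ‖g x‖ := by
    rw [norm_mul]
    exact mul_le_of_le_one_left (norm_nonneg _) (norm_le_one_of_mem_Icc (h x))
  have hfg : MemLp (fun x ↦ f x * g x) 2 μ :=
    hg.mono (hf.aestronglyMeasurable.mul hg.1) (ae_of_all _ hle)
  exact (sq_integral_le_integral_sq hfg).trans <|
    integral_mono hfg.integrable_sq hg.integrable_sq fun x ↦ sq_le_sq.2 (hle x)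

lemma le_measureReal_of_eventually_le_integral [IsFiniteMeasure μ] {S : Set α}
    (hS : MeasurableSet S) {q : ℕ → α → ℝ} (hq : ∀ n, Measurable (q n))
    (hq01 : ∀ n x, q n x ∈ Icc 0 1) (hlim : ∀ x ∉ S, Tendsto (fun n ↦ q n x) atTop (𝓝 0)) {a : ℝ}
    (ha : ∀ᶠ n in atTop, a ≤ ∫ x, q n x ∂μ) : a ≤ μ.real S := by
  have hint (n : ℕ) : Integrable (q n) μ := integrable_of_forall_mem_Icc (hq n) (hq01 n)
  have hle (n : ℕ) : ∫ x, q n x ∂μ ≤ μ.real S + ∫ x in Sᶜ, q n x ∂μ := by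
    rw [← integral_add_compl hS (hint n)]
    gcongr
    simpa using setIntegral_mono (μ := μ) (s := S) (hint n).integrableOn
      (integrable_const (1 : ℝ)).integrableOn fun x ↦ (hq01 n x).2
  have hcompl : Tendsto (fun n ↦ ∫ x in Sᶜ, q n x ∂μ) atTop (𝓝 0) := by
    simpa using tendsto_integral_of_dominated_convergence (μ := μ.restrict Sᶜ) (fun _ ↦ (1 : ℝ))
      (fun n ↦ (hq n).aestronglyMeasurable) (integrable_const 1)
      (fun n ↦ ae_of_all _ fun x ↦ norm_le_one_of_mem_Icc (hq01 n x))
      (ae_restrict_of_forall_mem hS.compl hlim)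
  have hbound := hcompl.const_add (μ.real S)
  rw [add_zero] at hbound
  exact ge_of_tendsto hbound (ha.mono fun n hn ↦ hn.trans (hle n))

end BoundedIntegrals

/-! ### The standard Gaussian measure on a Euclidean space -/

section StdGaussian

variable {E : Type*} [NormedAddCommGroup E] [InnerProductSpace ℝ E] [FiniteDimensional ℝ E]
  [MeasurableSpace E] [BorelSpace E]

lemma map_inner_stdGaussian (u : E) :
    (stdGaussian E).map (fun y ↦ ⟪u, y⟫) = gaussianReal 0 (‖u‖₊ ^ 2) := by
  have h := IsGaussian.map_eq_gaussianReal (μ := stdGaussian E) (innerSL ℝ u)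
  rw [integral_strongDual_stdGaussian, variance_dual_stdGaussian, innerSL_apply_norm] at h
  rw [show ‖u‖₊ ^ 2 = (‖u‖ ^ 2).toNNReal by
    rw [Real.toNNReal_pow (norm_nonneg u), norm_toNNReal]]
  exact h

lemma integral_exp_mul_inner_stdGaussian (u : E) (t : ℝ) :
    ∫ y, Real.exp (t * ⟪u, y⟫) ∂stdGaussian E = Real.exp (‖u‖ ^ 2 * t ^ 2 / 2) := by
  simpa [mgf] using mgf_gaussianReal (map_inner_stdGaussian u) t

lemma integrable_exp_mul_inner_stdGaussian (u : E) (t : ℝ) :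
    Integrable (fun y ↦ Real.exp (t * ⟪u, y⟫)) (stdGaussian E) := by
  have h := integrable_exp_mul_gaussianReal (μ := 0) (v := ‖u‖₊ ^ 2) t
  rw [← map_inner_stdGaussian u] at h
  exact h.comp_measurable (by fun_prop)

lemma integrable_norm_pow_stdGaussian (k : ℕ) :
    Integrable (fun y : E ↦ ‖y‖ ^ k) (stdGaussian E) := by
  simpa using (IsGaussian.memLp_id (stdGaussian E) k (by simp)).integrable_norm_pow'

lemma memLp_inner_stdGaussian (u : E) : MemLp (fun y ↦ ⟪u, y⟫) 2 (stdGaussian E) := by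
  simpa using IsGaussian.memLp_dual (stdGaussian E) (innerSL ℝ u) 2 (by simp)

lemma integrable_inner_stdGaussian (u : E) : Integrable (fun y ↦ ⟪u, y⟫) (stdGaussian E) :=
  (memLp_inner_stdGaussian u).integrable one_le_two

lemma integral_inner_stdGaussian (u : E) : ∫ y, ⟪u, y⟫ ∂stdGaussian E = 0 := by
  simpa using integral_strongDual_stdGaussian (innerSL ℝ u)

lemma integral_inner_sq_stdGaussian (u : E) :
    ∫ y, ⟪u, y⟫ ^ 2 ∂stdGaussian E = ‖u‖ ^ 2 := by
  have h := variance_dual_stdGaussian (innerSL ℝ u)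
  rw [variance_of_integral_eq_zero (by fun_prop) (integral_strongDual_stdGaussian _)] at h
  simpa using h

lemma integral_cexp_stdGaussian (u s : E) :
    ∫ y, Complex.exp ((⟪u, y⟫ : ℂ) + ⟪y, s⟫ * Complex.I) ∂stdGaussian E
      = Complex.exp ((‖u‖ ^ 2 - ‖s‖ ^ 2) / 2 + ⟪u, s⟫ * Complex.I) := by
  rw [stdGaussian, integral_map (Measurable.aemeasurable (by fun_prop))
    (Measurable.aestronglyMeasurable (by fun_prop))]
  set b := stdOrthonormalBasis ℝ E
  have hprod (x : Fin (Module.finrank ℝ E) → ℝ) :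
      Complex.exp (((⟪u, ∑ i, x i • b i⟫ : ℝ) : ℂ) + (⟪∑ i, x i • b i, s⟫ : ℝ) * Complex.I)
      = ∏ i, Complex.exp (((⟪u, b i⟫ : ℝ) + (⟪b i, s⟫ : ℝ) * Complex.I) * x i) := by
    rw [← Complex.exp_sum, inner_sum, sum_inner]
    simp only [inner_smul_left, inner_smul_right, Complex.ofReal_sum, Finset.sum_mul,
      ← Finset.sum_add_distrib]
    congr 1
    refine Finset.sum_congr rfl fun i _ ↦ ?_
    simp only [Complex.ofReal_mul, conj_trivial]
    ring
  have hmgf (z : ℂ) :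
      ∫ x : ℝ, Complex.exp (z * x) ∂gaussianReal 0 1 = Complex.exp (z ^ 2 / 2) := by
    simpa [complexMGF] using complexMGF_id_gaussianReal (μ := 0) (v := 1) z
  simp_rw [hprod]
  rw [integral_fintype_prod_eq_prod
    (f := fun i (x : ℝ) ↦ Complex.exp (((⟪u, b i⟫ : ℝ) + (⟪b i, s⟫ : ℝ) * Complex.I) * x))]
  simp_rw [hmgf]
  rw [← Complex.exp_sum, ← Complex.ofReal_pow, ← Complex.ofReal_pow, ← b.sum_sq_inner_left u,
    ← b.sum_sq_inner_right s, ← b.sum_inner_mul_inner u s]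
  push_cast
  rw [← Finset.sum_sub_distrib, Finset.sum_div, Finset.sum_mul, ← Finset.sum_add_distrib]
  congr 1
  refine Finset.sum_congr rfl fun i _ ↦ ?_
  ring_nf
  rw [Complex.I_sq]
  ring

/-- The Cameron-Martin density: that of the standard Gaussian measure translated by `u`, with
respect to the standard Gaussian measure itself. -/
def gaussTilt (u y : E) : ℝ := Real.exp (⟪u, y⟫ - ‖u‖ ^ 2 / 2)

lemma gaussTilt_eq_div (u y : E) :
    gaussTilt u y = Real.exp ⟪u, y⟫ / ∫ y, Real.exp ⟪u, y⟫ ∂stdGaussian E := by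
  have hZ := integral_exp_mul_inner_stdGaussian u 1
  simp only [one_mul, one_pow, mul_one] at hZ
  rw [gaussTilt, Real.exp_sub, hZ]

lemma map_add_right_stdGaussian (u : E) :
    (stdGaussian E).map (· + u) = (stdGaussian E).tilted (fun y ↦ ⟪u, y⟫) := by
  have hint : Integrable (fun y ↦ Real.exp ⟪u, y⟫) (stdGaussian E) := by
    simpa using integrable_exp_mul_inner_stdGaussian u 1
  have := isProbabilityMeasure_tilted hint
  have : IsProbabilityMeasure ((stdGaussian E).map (· + u)) :=
    Measure.isProbabilityMeasure_map (by fun_prop)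
  refine Measure.ext_of_charFun (funext fun s ↦ ?_)
  rw [charFun_map_add_const, charFun_stdGaussian, charFun_apply, integral_tilted]
  have hexp (y : E) : gaussTilt u y • Complex.exp (⟪y, s⟫ * Complex.I)
      = Complex.exp (-(‖u‖ ^ 2 / 2)) * Complex.exp ((⟪u, y⟫ : ℂ) + ⟪y, s⟫ * Complex.I) := by
    rw [gaussTilt, Complex.real_smul, Complex.ofReal_exp, ← Complex.exp_add, ← Complex.exp_add]
    congr 1
    push_cast
    ring
  simp_rw [← gaussTilt_eq_div, hexp]
  rw [integral_const_mul, integral_cexp_stdGaussian, ← Complex.exp_add, ← Complex.exp_add]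
  congr 1
  ring

lemma integral_add_stdGaussian {F : E → ℝ} (hF : Measurable F) (u : E) :
    ∫ y, F (y + u) ∂stdGaussian E = ∫ y, gaussTilt u y * F y ∂stdGaussian E := by
  rw [← integral_map (φ := (· + u)) (by fun_prop) hF.aestronglyMeasurable,
    map_add_right_stdGaussian, integral_tilted]
  simp_rw [← gaussTilt_eq_div, smul_eq_mul]

omit [FiniteDimensional ℝ E] [MeasurableSpace E] [BorelSpace E] in
lemma gaussTilt_sq (u y : E) :
    gaussTilt u y ^ 2 = Real.exp (-‖u‖ ^ 2) * Real.exp (2 * ⟪u, y⟫) := by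
  rw [gaussTilt, ← Real.exp_nat_mul, ← Real.exp_add]
  congr 1
  push_cast
  ring

lemma memLp_gaussTilt (u : E) : MemLp (gaussTilt u) 2 (stdGaussian E) := by
  refine (memLp_two_iff_integrable_sq ?_).2 ?_
  · exact Measurable.aestronglyMeasurable (by unfold gaussTilt; fun_prop)
  · simp_rw [gaussTilt_sq]
    exact (integrable_exp_mul_inner_stdGaussian u 2).const_mul _

lemma integral_gaussTilt (u : E) : ∫ y, gaussTilt u y ∂stdGaussian E = 1 := by
  simpa using (integral_add_stdGaussian (F := fun _ : E ↦ 1) measurable_const u).symm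

lemma integral_gaussTilt_sq (u : E) :
    ∫ y, gaussTilt u y ^ 2 ∂stdGaussian E = Real.exp (‖u‖ ^ 2) := by
  simp_rw [gaussTilt_sq]
  rw [integral_const_mul, integral_exp_mul_inner_stdGaussian, ← Real.exp_add]
  congr 1
  ring

lemma integral_gaussTilt_mul_inner (u : E) :
    ∫ y, gaussTilt u y * ⟪u, y⟫ ∂stdGaussian E = ‖u‖ ^ 2 := by
  rw [← integral_add_stdGaussian (F := fun y ↦ ⟪u, y⟫) (by fun_prop)]
  simp_rw [inner_add_right, real_inner_self_eq_norm_sq]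
  rw [integral_add (integrable_inner_stdGaussian u) (integrable_const _),
    integral_inner_stdGaussian]
  simp

lemma memLp_gaussTilt_sub_sub (u : E) :
    MemLp (fun y ↦ gaussTilt u y - 1 - ⟪u, y⟫) 2 (stdGaussian E) :=
  ((memLp_gaussTilt u).sub (memLp_const 1)).sub (memLp_inner_stdGaussian u)

lemma integral_gaussTilt_sub_sub_sq (u : E) :
    ∫ y, (gaussTilt u y - 1 - ⟪u, y⟫) ^ 2 ∂stdGaussian E = Real.exp (‖u‖ ^ 2) - 1 - ‖u‖ ^ 2 := by
  have hT : Integrable (gaussTilt u) (stdGaussian E) := (memLp_gaussTilt u).integrable one_le_two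
  have hX := integrable_inner_stdGaussian u
  have hT2 := (memLp_gaussTilt u).integrable_sq
  have hX2 := (memLp_inner_stdGaussian u).integrable_sq
  have hTX : Integrable (fun y ↦ gaussTilt u y * ⟪u, y⟫) (stdGaussian E) :=
    (memLp_gaussTilt u).integrable_mul (memLp_inner_stdGaussian u)
  have hexpand (y : E) : (gaussTilt u y - 1 - ⟪u, y⟫) ^ 2
      = gaussTilt u y ^ 2 + ⟪u, y⟫ ^ 2 - 2 * (gaussTilt u y * ⟪u, y⟫)
        - 2 * gaussTilt u y + 2 * ⟪u, y⟫ + 1 := by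
    ring
  simp_rw [hexpand]
  rw [integral_add (by fun_prop) (integrable_const 1), integral_add (by fun_prop) (by fun_prop),
    integral_sub (by fun_prop) (by fun_prop), integral_sub (by fun_prop) (by fun_prop),
    integral_add hT2 hX2]
  simp only [integral_const_mul, integral_gaussTilt, integral_gaussTilt_sq,
    integral_gaussTilt_mul_inner, integral_inner_stdGaussian, integral_inner_sq_stdGaussian,
    integral_const, probReal_univ, smul_eq_mul]
  ring

lemma conv_map_smul_stdGaussian (a b : ℝ) :
    ((stdGaussian E).map (a • ·)).conv ((stdGaussian E).map (b • ·))
      = (stdGaussian E).map (√(a ^ 2 + b ^ 2) • ·) := by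
  have hprob (r : ℝ) : IsProbabilityMeasure ((stdGaussian E).map (r • ·)) :=
    Measure.isProbabilityMeasure_map (by fun_prop)
  have := hprob a
  have := hprob b
  have := hprob √(a ^ 2 + b ^ 2)
  refine Measure.ext_of_charFun (funext fun s ↦ ?_)
  simp_rw [charFun_conv, charFun_map_smul, charFun_stdGaussian, norm_smul, ← Complex.exp_add]
  congr 1
  rw [← Complex.ofReal_pow, ← Complex.ofReal_pow, ← Complex.ofReal_pow, mul_pow, mul_pow, mul_pow]
  simp only [Real.norm_eq_abs, sq_abs, Real.sq_sqrt (add_nonneg (sq_nonneg a) (sq_nonneg b))]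
  push_cast
  ring

/-! ### The heat semigroup -/

/-- The heat semigroup at time `σ ^ 2 / 2`, that is, the average of `f` over a Gaussian of
standard deviation `σ` centred at `x`. -/
def gaussSmooth (σ : ℝ) (f : E → ℝ) (x : E) : ℝ := ∫ y, f (x + σ • y) ∂stdGaussian E

lemma measurable_gaussSmooth (σ : ℝ) {f : E → ℝ} (hf : Measurable f) :
    Measurable (gaussSmooth σ f) := by
  have : StronglyMeasurable (Function.uncurry fun x y : E ↦ f (x + σ • y)) :=
    Measurable.stronglyMeasurable (by simp only [Function.uncurry_def]; fun_prop)
  exact this.integral_prod_right.measurable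

lemma gaussSmooth_mem_Icc (σ : ℝ) {f : E → ℝ} (hf : Measurable f) {a b : ℝ}
    (h : ∀ x, f x ∈ Icc a b) (x : E) : gaussSmooth σ f x ∈ Icc a b :=
  integral_mem_Icc_of_forall (by fun_prop) fun _ ↦ h _

omit [BorelSpace E] in
lemma gaussSmooth_zero (σ : ℝ) (f : E → ℝ) :
    gaussSmooth σ f 0 = ∫ y, f (σ • y) ∂stdGaussian E := by
  simp only [gaussSmooth, zero_add]

omit [BorelSpace E] in
lemma gaussSmooth_comp_add_smul (σ τ : ℝ) (f : E → ℝ) (x z : E) :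
    gaussSmooth τ (fun y ↦ f (x + σ • y)) z = gaussSmooth (σ * τ) f (x + σ • z) := by
  simp only [gaussSmooth, smul_add, smul_smul, add_assoc]

lemma gaussSmooth_eq_integral_map (σ : ℝ) {f : E → ℝ} (hf : Measurable f) (x : E) :
    gaussSmooth σ f x = ∫ z, f (x + z) ∂(stdGaussian E).map (σ • ·) := by
  rw [integral_map (by fun_prop) (Measurable.aestronglyMeasurable (by fun_prop)), gaussSmooth]

lemma gaussSmooth_gaussSmooth (σ τ : ℝ) {f : E → ℝ} (hf : Measurable f) {a b : ℝ}
    (h : ∀ x, f x ∈ Icc a b) (x : E) :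
    gaussSmooth σ (gaussSmooth τ f) x = gaussSmooth √(σ ^ 2 + τ ^ 2) f x := by
  have hprob (r : ℝ) : IsProbabilityMeasure ((stdGaussian E).map (r • ·)) :=
    Measure.isProbabilityMeasure_map (by fun_prop)
  have := hprob σ
  have := hprob τ
  rw [gaussSmooth_eq_integral_map _ hf, ← conv_map_smul_stdGaussian,
    integral_conv (integrable_of_forall_mem_Icc (by fun_prop) fun _ ↦ h _),
    gaussSmooth_eq_integral_map _ (measurable_gaussSmooth τ hf)]
  simp_rw [gaussSmooth_eq_integral_map τ hf, add_assoc]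

/-! ### The Gaussian barycentre -/

section GaussMoment

variable {f : E → ℝ}

/-- The barycentre `∫ f(y) y dν(y)` of the measure with density `f` with respect to the standard
Gaussian measure `ν`. It is the gradient at the origin of the heat flow `gaussSmooth 1 f`. -/
def gaussMoment (f : E → ℝ) : E := ∫ y, f y • y ∂stdGaussian E

lemma inner_gaussMoment (hf : Measurable f) (h : ∀ x, f x ∈ Icc 0 1) (u : E) :
    ⟪u, gaussMoment f⟫ = ∫ y, f y * ⟪u, y⟫ ∂stdGaussian E := by
  have hint : Integrable (fun y ↦ f y • y) (stdGaussian E) :=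
    IsGaussian.integrable_id.bdd_smul 1 hf.aestronglyMeasurable
      (ae_of_all _ fun x ↦ norm_le_one_of_mem_Icc (h x))
  rw [gaussMoment, ← integral_inner hint]
  simp_rw [inner_smul_right]

lemma abs_inner_gaussMoment_le (hf : Measurable f) (h : ∀ x, f x ∈ Icc 0 1) (u : E) :
    |⟪u, gaussMoment f⟫| ≤ ‖u‖ := by
  refine abs_le_of_sq_le_sq ?_ (norm_nonneg u)
  rw [inner_gaussMoment hf h, ← integral_inner_sq_stdGaussian]
  exact sq_integral_mul_le hf h (memLp_inner_stdGaussian u)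

lemma gaussSmooth_one_sub_eq (hf : Measurable f) (h : ∀ x, f x ∈ Icc 0 1) (u : E) :
    gaussSmooth 1 f u - gaussSmooth 1 f 0 - ⟪u, gaussMoment f⟫
      = ∫ y, f y * (gaussTilt u y - 1 - ⟪u, y⟫) ∂stdGaussian E := by
  have hfi : Integrable f (stdGaussian E) := integrable_of_forall_mem_Icc hf h
  have hT := integrable_mul_of_mem_Icc hf h ((memLp_gaussTilt u).integrable one_le_two)
  have hX := integrable_mul_of_mem_Icc hf h (integrable_inner_stdGaussian u)
  simp only [gaussSmooth, one_smul, zero_add, add_comm u]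
  rw [integral_add_stdGaussian hf, inner_gaussMoment hf h]
  simp_rw [mul_sub, mul_one, mul_comm (gaussTilt u _)]
  rw [← integral_sub hT hfi, ← integral_sub (by fun_prop) hX]

lemma abs_gaussSmooth_one_sub_le (hf : Measurable f) (h : ∀ x, f x ∈ Icc 0 1) (u : E) :
    |gaussSmooth 1 f u - gaussSmooth 1 f 0 - ⟪u, gaussMoment f⟫| ≤ 2 * ‖u‖ ^ 2 := by
  rcases le_total ‖u‖ 1 with hu | hu
  · have hsq : (gaussSmooth 1 f u - gaussSmooth 1 f 0 - ⟪u, gaussMoment f⟫) ^ 2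
        ≤ (‖u‖ ^ 2) ^ 2 := by
      rw [gaussSmooth_one_sub_eq hf h]
      refine (sq_integral_mul_le hf h (memLp_gaussTilt_sub_sub u)).trans ?_
      rw [integral_gaussTilt_sub_sub_sq]
      refine le_of_abs_le (Real.abs_exp_sub_one_sub_id_le ?_)
      rw [abs_of_nonneg (sq_nonneg _)]
      exact pow_le_one₀ (norm_nonneg u) hu
    exact (abs_le_of_sq_le_sq hsq (sq_nonneg _)).trans (by linarith [sq_nonneg ‖u‖])
  · have hsub : |gaussSmooth 1 f u - gaussSmooth 1 f 0| ≤ 1 :=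
      abs_sub_le_of_le_of_le (gaussSmooth_mem_Icc 1 hf h u).1 (gaussSmooth_mem_Icc 1 hf h u).2
        (gaussSmooth_mem_Icc 1 hf h 0).1 (gaussSmooth_mem_Icc 1 hf h 0).2 |>.trans_eq (sub_zero 1)
    calc |gaussSmooth 1 f u - gaussSmooth 1 f 0 - ⟪u, gaussMoment f⟫|
        ≤ |gaussSmooth 1 f u - gaussSmooth 1 f 0| + |⟪u, gaussMoment f⟫| := abs_sub _ _
      _ ≤ 1 + ‖u‖ := add_le_add hsub (abs_inner_gaussMoment_le hf h u)
      _ ≤ 2 * ‖u‖ ^ 2 := by nlinarith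

lemma tendsto_gaussPDF_atBot : Tendsto gaussPDF atBot (𝓝 0) := by
  have hsq : Tendsto (fun x : ℝ ↦ x ^ 2) atBot atTop := by
    simpa [Function.comp_def] using
      (tendsto_pow_atTop (α := ℝ) two_ne_zero).comp tendsto_neg_atBot_atTop
  rw [show gaussPDF = _ from funext gaussPDF_eq, ← mul_zero (√(2 * Real.pi))⁻¹]
  exact (Real.tendsto_exp_atBot.comp
    ((tendsto_neg_atTop_atBot.comp hsq).atBot_div_const two_pos)).const_mul _

lemma integrable_mul_gaussPDF : Integrable fun u ↦ -u * gaussPDF u := by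
  have h := (integrable_mul_exp_neg_mul_sq (b := 1 / 2) (by norm_num)).const_mul
    (-(√(2 * Real.pi))⁻¹)
  refine h.congr (ae_of_all _ fun u ↦ ?_)
  simp only [gaussPDF_eq]
  ring_nf

lemma integral_Iic_mul_gaussPDF (w : ℝ) : ∫ u in Iic w, -u * gaussPDF u = gaussPDF w := by
  simpa using integral_Iic_of_hasDerivAt_of_tendsto' (fun x _ ↦ hasDerivAt_gaussPDF x)
    integrable_mul_gaussPDF.integrableOn tendsto_gaussPDF_atBot

lemma integral_max_sub_zero_gaussianReal (w : ℝ) :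
    ∫ u, max (w - u) 0 ∂gaussianReal 0 1 = w * gaussCDF w + gaussPDF w := by
  have hid : Integrable (fun u : ℝ ↦ u) (gaussianReal 0 1) := IsGaussian.integrable_id
  have hmax (u : ℝ) : max (w - u) 0 = (Iic w).indicator (w - ·) u := by
    by_cases hu : u ∈ Iic w
    · rw [indicator_of_mem hu, max_eq_left (sub_nonneg.2 hu)]
    · rw [indicator_of_notMem hu, max_eq_right (sub_nonpos.2 (not_le.1 hu).le)]
  have hneg : ∫ u in Iic w, u ∂gaussianReal 0 1 = -gaussPDF w := by
    rw [← integral_Iic_mul_gaussPDF, ← integral_neg, ← integral_indicator measurableSet_Iic,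
      integral_gaussianReal_eq_integral_smul one_ne_zero, ← integral_indicator measurableSet_Iic]
    refine integral_congr_ae (ae_of_all _ fun u ↦ ?_)
    by_cases hu : u ∈ Iic w
    · simp [hu, mul_comm]
    · simp [hu]
  simp_rw [hmax]
  rw [integral_indicator measurableSet_Iic,
    integral_sub (integrable_const w).integrableOn hid.integrableOn, setIntegral_const, hneg,
    ← gaussCDF_coe, smul_eq_mul, mul_comm w, sub_neg_eq_add]

-- The bathtub principle: `0 ≤ f ≤ 1` forces `f y * t ≤ max t 0` for `t = w - ⟪e, y⟫`.
lemma mul_gaussCDF_sub_inner_gaussMoment_le (hf : Measurable f) (h : ∀ x, f x ∈ Icc 0 1) (w : ℝ)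
    {e : E} (he : ‖e‖ = 1) :
    w * ∫ y, f y ∂stdGaussian E - ⟪e, gaussMoment f⟫ ≤ w * gaussCDF w + gaussPDF w := by
  have hmap : (stdGaussian E).map (fun y ↦ ⟪e, y⟫) = gaussianReal 0 1 := by
    rw [map_inner_stdGaussian, show ‖e‖₊ = 1 from NNReal.eq he, one_pow]
  have hX := integrable_inner_stdGaussian e
  have hsub : Integrable (fun y ↦ w - ⟪e, y⟫) (stdGaussian E) := (integrable_const w).sub hX
  have hle (y : E) : f y * (w - ⟪e, y⟫) ≤ max (w - ⟪e, y⟫) 0 :=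
    (mul_le_mul_of_nonneg_left (le_max_left _ 0) (h y).1).trans
      (mul_le_of_le_one_left (le_max_right _ _) (h y).2)
  calc w * ∫ y, f y ∂stdGaussian E - ⟪e, gaussMoment f⟫
      = ∫ y, f y * (w - ⟪e, y⟫) ∂stdGaussian E := by
        rw [inner_gaussMoment hf h, mul_comm w, ← integral_mul_const, ← integral_sub
          ((integrable_of_forall_mem_Icc hf h).mul_const w) (integrable_mul_of_mem_Icc hf h hX)]
        simp_rw [mul_sub]
    _ ≤ ∫ y, max (w - ⟪e, y⟫) 0 ∂stdGaussian E :=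
        integral_mono (integrable_mul_of_mem_Icc hf h hsub) hsub.pos_part hle
    _ = w * gaussCDF w + gaussPDF w := by
        rw [← integral_max_sub_zero_gaussianReal, ← hmap, integral_map (by fun_prop)
          (Measurable.aestronglyMeasurable (by fun_prop))]

lemma norm_gaussMoment_le (hf : Measurable f) (h : ∀ x, f x ∈ Icc 0 1) {w : ℝ}
    (hw : ∫ y, f y ∂stdGaussian E = gaussCDF w) : ‖gaussMoment f‖ ≤ gaussPDF w := by
  rcases eq_or_ne (gaussMoment f) 0 with hm | hm
  · rw [hm, norm_zero]
    exact (gaussPDF_pos w).le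
  have hunit : ‖-(‖gaussMoment f‖⁻¹ • gaussMoment f)‖ = 1 := by
    rw [norm_neg]
    exact norm_smul_inv_norm hm
  have hle := mul_gaussCDF_sub_inner_gaussMoment_le hf h w hunit
  rw [hw, inner_neg_left, real_inner_smul_left, real_inner_self_eq_norm_mul_norm,
    inv_mul_cancel_left₀ (norm_ne_zero_iff.2 hm)] at hle
  linarith

end GaussMoment

/-! ### One step of the heat flow -/

section HeatStep

lemma exists_le_integral_gaussShift {α : Type*} [MeasurableSpace α] (μ : Measure α)
    [IsProbabilityMeasure μ] (C M : ℝ) : ∃ A : ℝ≥0, ∀ c ∈ Icc 0 C, ∀ q : α → ℝ, Measurable q →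
    (∀ x, q x ∈ Icc (gaussCDF (-M : ℝ)) (gaussCDF M)) → ∀ a, ∫ x, q x ∂μ = a →
    gaussShift c a + gaussShiftDeriv₂ c a / 2 * ∫ x, (q x - a) ^ 2 ∂μ - A * ∫ x, |q x - a| ^ 3 ∂μ
      ≤ ∫ x, gaussShift c (q x) ∂μ := by
  obtain ⟨A, hA⟩ := exists_gaussShift_taylor_two C M
  refine ⟨A, fun c hc q hq hqM a ha ↦ ?_⟩
  have haM : a ∈ Icc (gaussCDF (-M : ℝ)) (gaussCDF M) := ha ▸ integral_mem_Icc_of_forall hq hqM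
  have hdist (x : α) : |q x - a| ≤ gaussCDF M - gaussCDF (-M : ℝ) :=
    abs_sub_le_of_le_of_le (hqM x).1 (hqM x).2 haM.1 haM.2
  have hqi : Integrable q μ := integrable_of_forall_mem_Icc hq hqM
  have hint (k : ℕ) : Integrable (fun x ↦ |q x - a| ^ k) μ :=
    integrable_of_forall_mem_Icc (by fun_prop) fun x ↦
      ⟨pow_nonneg (abs_nonneg _) k, pow_le_pow_left₀ (abs_nonneg _) (hdist x) k⟩
  have hsq := hint 2
  simp only [sq_abs] at hsq
  have hle := integral_mono (μ := μ) (by fun_prop) (integrable_of_forall_mem_Icc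
    ((gaussShift_mono c).measurable.comp hq) fun x ↦ gaussShift_mem_Icc c (q x))
    fun x ↦ hA c hc a haM (q x) (hqM x)
  refine le_of_eq_of_le ?_ hle
  rw [integral_sub (by fun_prop) (by fun_prop), integral_add (by fun_prop) (by fun_prop),
    integral_add (by fun_prop) (by fun_prop), integral_const_mul, integral_const_mul,
    integral_const_mul, integral_sub hqi (integrable_const a), ha]
  simp

variable {f : E → ℝ}

lemma integral_gaussSmooth_one_smul (hf : Measurable f) (hf01 : ∀ x, f x ∈ Icc 0 1) (h : ℝ) :
    ∫ z, gaussSmooth 1 f (h • z) ∂stdGaussian E = gaussSmooth √(1 + h ^ 2) f 0 := by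
  rw [← gaussSmooth_zero, gaussSmooth_gaussSmooth h 1 hf hf01, one_pow, add_comm]

lemma measurable_gaussSmooth_one_smul (hf : Measurable f) (h : ℝ) :
    Measurable fun z ↦ gaussSmooth 1 f (h • z) :=
  (measurable_gaussSmooth 1 hf).comp (by fun_prop)

lemma integrable_gaussSmooth_one_smul (hf : Measurable f) (hf01 : ∀ x, f x ∈ Icc 0 1) (h : ℝ) :
    Integrable (fun z ↦ gaussSmooth 1 f (h • z)) (stdGaussian E) :=
  integrable_of_forall_mem_Icc (measurable_gaussSmooth_one_smul hf h) fun z ↦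
    gaussSmooth_mem_Icc 1 hf hf01 (h • z)

lemma abs_gaussSmooth_one_smul_sub_le (hf : Measurable f) (hf01 : ∀ x, f x ∈ Icc 0 1) (h : ℝ)
    (z : E) :
    |gaussSmooth 1 f (h • z) - gaussSmooth 1 f 0 - h * ⟪z, gaussMoment f⟫|
      ≤ 2 * h ^ 2 * ‖z‖ ^ 2 := by
  have hle := abs_gaussSmooth_one_sub_le hf hf01 (h • z)
  rwa [real_inner_smul_left, norm_smul, mul_pow, Real.norm_eq_abs, sq_abs, ← mul_assoc] at hle

lemma abs_gaussSmooth_sqrt_sub_le (hf : Measurable f) (hf01 : ∀ x, f x ∈ Icc 0 1) (h : ℝ) :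
    |gaussSmooth √(1 + h ^ 2) f 0 - gaussSmooth 1 f 0|
      ≤ 2 * h ^ 2 * ∫ z : E, ‖z‖ ^ 2 ∂stdGaussian E := by
  have hq := integrable_gaussSmooth_one_smul hf hf01 h
  have hX : Integrable (fun z ↦ h * ⟪z, gaussMoment f⟫) (stdGaussian E) := by
    simpa only [real_inner_comm] using (integrable_inner_stdGaussian (gaussMoment f)).const_mul h
  have hmean : ∫ z, ⟪z, gaussMoment f⟫ ∂stdGaussian E = 0 := by
    simpa only [real_inner_comm] using integral_inner_stdGaussian (gaussMoment f)
  have hdrift : gaussSmooth √(1 + h ^ 2) f 0 - gaussSmooth 1 f 0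
      = ∫ z, (gaussSmooth 1 f (h • z) - gaussSmooth 1 f 0 - h * ⟪z, gaussMoment f⟫)
        ∂stdGaussian E := by
    rw [integral_sub (by fun_prop) hX, integral_sub hq (by fun_prop),
      integral_gaussSmooth_one_smul hf hf01, integral_const_mul, hmean]
    simp
  rw [hdrift, ← integral_const_mul, ← Real.norm_eq_abs]
  exact norm_integral_le_of_norm_le ((integrable_norm_pow_stdGaussian 2).const_mul _)
    (ae_of_all _ (abs_gaussSmooth_one_smul_sub_le hf hf01 h))

lemma sq_gaussSmooth_one_smul_sub_le (hf : Measurable f) (hf01 : ∀ x, f x ∈ Icc 0 1) {h : ℝ}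
    (hh : h ∈ Icc (0 : ℝ) 1) (z : E) :
    (gaussSmooth 1 f (h • z) - gaussSmooth 1 f 0) ^ 2
      ≤ h ^ 2 * ⟪gaussMoment f, z⟫ ^ 2 + h ^ 3 * (4 * ‖z‖ ^ 3 + 4 * ‖z‖ ^ 4) := by
  have hR := abs_gaussSmooth_one_smul_sub_le hf hf01 h z
  have hX := abs_inner_gaussMoment_le hf hf01 z
  rw [real_inner_comm] at hR hX
  set X := ⟪gaussMoment f, z⟫
  set R := gaussSmooth 1 f (h • z) - gaussSmooth 1 f 0 - h * X with hR_def
  have hXR : X * R ≤ ‖z‖ * (2 * h ^ 2 * ‖z‖ ^ 2) := by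
    refine (le_abs_self _).trans ?_
    rw [abs_mul]
    gcongr
  have hRsq : R ^ 2 ≤ (2 * h ^ 2 * ‖z‖ ^ 2) ^ 2 := sq_le_sq' (abs_le.1 hR).1 (abs_le.1 hR).2
  have hpow : h ^ 4 ≤ h ^ 3 := pow_le_pow_of_le_one hh.1 hh.2 (by norm_num)
  calc (gaussSmooth 1 f (h • z) - gaussSmooth 1 f 0) ^ 2
      = h ^ 2 * X ^ 2 + 2 * (h * (X * R)) + R ^ 2 := by
        rw [hR_def]
        ring
    _ ≤ h ^ 2 * X ^ 2 + 2 * (h * (‖z‖ * (2 * h ^ 2 * ‖z‖ ^ 2))) + (2 * h ^ 2 * ‖z‖ ^ 2) ^ 2 := by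
        have := mul_le_mul_of_nonneg_left hXR hh.1
        linarith
    _ = h ^ 2 * X ^ 2 + 4 * ‖z‖ ^ 3 * h ^ 3 + 4 * ‖z‖ ^ 4 * h ^ 4 := by ring
    _ ≤ h ^ 2 * X ^ 2 + 4 * ‖z‖ ^ 3 * h ^ 3 + 4 * ‖z‖ ^ 4 * h ^ 3 := by gcongr
    _ = h ^ 2 * X ^ 2 + h ^ 3 * (4 * ‖z‖ ^ 3 + 4 * ‖z‖ ^ 4) := by ring

lemma integral_sq_gaussSmooth_sub_le (hf : Measurable f) (hf01 : ∀ x, f x ∈ Icc 0 1) {h : ℝ}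
    (hh : h ∈ Icc (0 : ℝ) 1) :
    ∫ z, (gaussSmooth 1 f (h • z) - gaussSmooth √(1 + h ^ 2) f 0) ^ 2 ∂stdGaussian E
      ≤ h ^ 2 * ‖gaussMoment f‖ ^ 2
        + h ^ 3 * ∫ z : E, (4 * ‖z‖ ^ 3 + 4 * ‖z‖ ^ 4) ∂stdGaussian E := by
  have hXsq := (memLp_inner_stdGaussian (gaussMoment f)).integrable_sq
  have hnorm3 := integrable_norm_pow_stdGaussian (E := E) 3
  have hnorm4 := integrable_norm_pow_stdGaussian (E := E) 4
  rw [← integral_gaussSmooth_one_smul hf hf01]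
  refine (integral_sub_integral_sq_le (measurable_gaussSmooth_one_smul hf h).aemeasurable
    (gaussSmooth 1 f 0)).trans ?_
  refine (integral_mono_of_nonneg (ae_of_all _ fun z ↦ sq_nonneg _) (by fun_prop)
    (ae_of_all _ (sq_gaussSmooth_one_smul_sub_le hf hf01 hh))).trans_eq ?_
  rw [integral_add (by fun_prop) (by fun_prop), integral_const_mul, integral_const_mul,
    integral_inner_sq_stdGaussian]

lemma abs_gaussSmooth_one_smul_sub_gaussSmooth_sqrt_le (hf : Measurable f)
    (hf01 : ∀ x, f x ∈ Icc 0 1) {h : ℝ} (hh : h ∈ Icc (0 : ℝ) 1) (z : E) :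
    |gaussSmooth 1 f (h • z) - gaussSmooth √(1 + h ^ 2) f 0|
      ≤ h * (‖z‖ + 2 * ‖z‖ ^ 2 + 2 * ∫ y : E, ‖y‖ ^ 2 ∂stdGaussian E) := by
  set m₂ := ∫ y : E, ‖y‖ ^ 2 ∂stdGaussian E
  have : 0 ≤ m₂ := integral_nonneg fun y ↦ by positivity
  have hR := abs_gaussSmooth_one_smul_sub_le hf hf01 h z
  have hX : |h * ⟪z, gaussMoment f⟫| ≤ h * ‖z‖ := by
    rw [abs_mul, abs_of_nonneg hh.1]
    exact mul_le_mul_of_nonneg_left (abs_inner_gaussMoment_le hf hf01 z) hh.1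
  have hdrift := abs_gaussSmooth_sqrt_sub_le hf hf01 h
  have hsq : h ^ 2 ≤ h := pow_le_of_le_one hh.1 hh.2 two_ne_zero
  have hsqz : h ^ 2 * ‖z‖ ^ 2 ≤ h * ‖z‖ ^ 2 := by gcongr
  have hsqm : h ^ 2 * m₂ ≤ h * m₂ := by gcongr
  rw [abs_le] at hR hX hdrift ⊢
  constructor <;> linarith

lemma exists_integral_abs_gaussSmooth_sub_cube_le (E : Type*) [NormedAddCommGroup E]
    [InnerProductSpace ℝ E] [FiniteDimensional ℝ E] [MeasurableSpace E] [BorelSpace E] :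
    ∃ K : ℝ, ∀ f : E → ℝ, Measurable f → (∀ x, f x ∈ Icc 0 1) → ∀ h ∈ Icc (0 : ℝ) 1,
      ∫ z, |gaussSmooth 1 f (h • z) - gaussSmooth √(1 + h ^ 2) f 0| ^ 3 ∂stdGaussian E
        ≤ K * h ^ 3 := by
  set m₂ := ∫ y : E, ‖y‖ ^ 2 ∂stdGaussian E
  have hint : Integrable (fun z : E ↦ (‖z‖ + 2 * ‖z‖ ^ 2 + 2 * m₂) ^ 3) (stdGaussian E) := by
    have hnorm := integrable_norm_pow_stdGaussian (E := E)
    have hexpand (z : E) : (‖z‖ + 2 * ‖z‖ ^ 2 + 2 * m₂) ^ 3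
        = 8 * ‖z‖ ^ 6 + 12 * ‖z‖ ^ 5 + (6 + 24 * m₂) * ‖z‖ ^ 4 + (1 + 24 * m₂) * ‖z‖ ^ 3
          + (6 * m₂ + 24 * m₂ ^ 2) * ‖z‖ ^ 2 + 12 * m₂ ^ 2 * ‖z‖ ^ 1 + 8 * m₂ ^ 3 := by
      ring
    simp_rw [hexpand]
    fun_prop
  refine ⟨∫ z : E, (‖z‖ + 2 * ‖z‖ ^ 2 + 2 * m₂) ^ 3 ∂stdGaussian E, fun f hf hf01 h hh ↦ ?_⟩
  rw [mul_comm, ← integral_const_mul]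
  refine integral_mono_of_nonneg (ae_of_all _ fun z ↦ by positivity) (hint.const_mul _)
    (ae_of_all _ fun z ↦ ?_)
  simp only [← mul_pow]
  exact pow_le_pow_left₀ (abs_nonneg _)
    (abs_gaussSmooth_one_smul_sub_gaussSmooth_sqrt_le hf hf01 hh z) 3

lemma sq_norm_gaussMoment_le {M : ℝ} (hf : Measurable f)
    (hfM : ∀ x, f x ∈ Icc (gaussCDF (-M : ℝ)) (gaussCDF M)) {h w : ℝ}
    (hw : gaussSmooth √(1 + h ^ 2) f 0 = gaussCDF w) :
    ‖gaussMoment f‖ ^ 2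
      ≤ gaussPDF w ^ 2 + 4 * M * (∫ z : E, ‖z‖ ^ 2 ∂stdGaussian E) * h ^ 2 := by
  have hf01 (x : E) : f x ∈ Icc 0 1 := Ioo_subset_Icc_self (Icc_gaussCDF_subset_Ioo _ _ (hfM x))
  obtain ⟨v, hvM, hv⟩ := exists_gaussCDF_eq_of_mem_Icc (gaussSmooth_mem_Icc 1 hf hfM 0)
  obtain ⟨w', hwM, hw'⟩ := exists_gaussCDF_eq_of_mem_Icc (gaussSmooth_mem_Icc √(1 + h ^ 2) hf hfM 0)
  obtain rfl : w' = w := strictMono_gaussCDF_coe.injective (hw'.trans hw)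
  have hm : ‖gaussMoment f‖ ≤ gaussPDF v := norm_gaussMoment_le hf hf01 (by
    rw [hv, gaussSmooth_zero]
    simp_rw [one_smul])
  have hM : 0 ≤ M := by linarith [hvM.1.trans hvM.2]
  have hdiff : |gaussPDF v - gaussPDF w'| ≤ M * (2 * h ^ 2 * ∫ z : E, ‖z‖ ^ 2 ∂stdGaussian E) := by
    refine (abs_gaussPDF_sub_le hwM hvM).trans ?_
    rw [hv, ← hw, abs_sub_comm]
    exact mul_le_mul_of_nonneg_left (abs_gaussSmooth_sqrt_sub_le hf hf01 h) hM
  have hsum : |gaussPDF v + gaussPDF w'| ≤ 2 := by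
    rw [abs_of_nonneg (add_nonneg (gaussPDF_pos v).le (gaussPDF_pos w').le)]
    linarith [gaussPDF_le_one v, gaussPDF_le_one w']
  have hsq : gaussPDF v ^ 2 - gaussPDF w' ^ 2
      ≤ 2 * (M * (2 * h ^ 2 * ∫ z : E, ‖z‖ ^ 2 ∂stdGaussian E)) := by
    rw [sq_sub_sq]
    refine (le_abs_self _).trans ?_
    rw [abs_mul]
    exact mul_le_mul hsum hdiff (abs_nonneg _) zero_le_two
  have hm_sq := pow_le_pow_left₀ (norm_nonneg _) hm 2
  linarith

lemma exists_gaussSmooth_step (E : Type*) [NormedAddCommGroup E] [InnerProductSpace ℝ E]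
    [FiniteDimensional ℝ E] [MeasurableSpace E] [BorelSpace E] (C M : ℝ) :
    ∃ K : ℝ, ∀ h ∈ Icc (0 : ℝ) 1, ∀ c ∈ Icc 0 C, ∀ f : E → ℝ, Measurable f →
      (∀ x, f x ∈ Icc (gaussCDF (-M : ℝ)) (gaussCDF M)) →
      gaussShift (c / √(1 + h ^ 2)) (gaussSmooth √(1 + h ^ 2) f 0)
        ≤ gaussSmooth h (fun z ↦ gaussShift c (gaussSmooth 1 f z)) 0 + K * h ^ 3 := by
  obtain ⟨A, hA⟩ := exists_le_integral_gaussShift (stdGaussian E) C M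
  obtain ⟨K₃, hK₃⟩ := exists_integral_abs_gaussSmooth_sub_cube_le E
  set K₂ := (∫ z : E, (4 * ‖z‖ ^ 3 + 4 * ‖z‖ ^ 4) ∂stdGaussian E)
    + 4 * M * ∫ z : E, ‖z‖ ^ 2 ∂stdGaussian E with hK₂
  refine ⟨C + C ^ 2 + C / gaussPDF M ^ 2 / 2 * K₂ + A * K₃, fun h hh c hc f hf hfM ↦ ?_⟩
  have hf01 (x : E) : f x ∈ Icc 0 1 := Ioo_subset_Icc_self (Icc_gaussCDF_subset_Ioo _ _ (hfM x))
  obtain ⟨w, hwM, hw⟩ := exists_gaussCDF_eq_of_mem_Icc (gaussSmooth_mem_Icc √(1 + h ^ 2) hf hfM 0)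
  have hjensen := hA c hc _ (measurable_gaussSmooth_one_smul hf h)
    (fun z ↦ gaussSmooth_mem_Icc 1 hf hfM (h • z)) _ (integral_gaussSmooth_one_smul hf hf01 h)
  have hcube := mul_le_mul_of_nonneg_left (hK₃ f hf hf01 h hh) A.coe_nonneg
  have hsq := integral_sq_gaussSmooth_sub_le hf hf01 hh
  have hm := sq_norm_gaussMoment_le hf hfM hw.symm
  rw [← gaussSmooth_zero h fun z ↦ gaussShift c (gaussSmooth 1 f z)] at hjensen
  rw [← hw] at hjensen hsq hcube ⊢
  have hM : 0 ≤ M := by linarith [hwM.1.trans hwM.2]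
  have hK₂_nonneg : 0 ≤ K₂ := by positivity
  have hvar : ∫ z, (gaussSmooth 1 f (h • z) - gaussCDF w) ^ 2 ∂stdGaussian E
      ≤ h ^ 2 * gaussPDF w ^ 2 + K₂ * h ^ 3 := by
    have hpow : h ^ 4 ≤ h ^ 3 := pow_le_pow_of_le_one hh.1 hh.2 (by norm_num)
    have hpow_mul : 4 * M * (∫ z : E, ‖z‖ ^ 2 ∂stdGaussian E) * h ^ 4
        ≤ 4 * M * (∫ z : E, ‖z‖ ^ 2 ∂stdGaussian E) * h ^ 3 :=
      mul_le_mul_of_nonneg_left hpow (by positivity)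
    have hm_mul := mul_le_mul_of_nonneg_left hm (sq_nonneg h)
    rw [hK₂]
    linarith
  have hsecond := neg_sub_le_gaussShiftDeriv₂_mul hc hwM
    (mul_nonneg hK₂_nonneg (pow_nonneg hh.1 3)) hvar
  have hshift := gaussCDF_add_div_sqrt_le hc.1 hh w
  have hcC : (c + c ^ 2) * h ^ 3 ≤ (C + C ^ 2) * h ^ 3 :=
    mul_le_mul_of_nonneg_right (add_le_add hc.2 (pow_le_pow_left₀ hc.1 hc.2 2))
      (pow_nonneg hh.1 3)
  rw [gaussShift_gaussCDF] at hjensen ⊢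
  linarith

end HeatStep

/-! ### Interpolation along the heat semigroup -/

lemma measurable_gaussShift_gaussSmooth (c σ : ℝ) {f : E → ℝ} (hf : Measurable f) :
    Measurable fun z ↦ gaussShift c (gaussSmooth σ f z) :=
  (gaussShift_mono c).measurable.comp (measurable_gaussSmooth σ hf)

lemma gaussSmooth_const_add_mul (σ k l : ℝ) {f : E → ℝ} (hf : Measurable f)
    (hf01 : ∀ x, f x ∈ Icc 0 1) (x : E) :
    gaussSmooth σ (fun y ↦ k + l * f y) x = k + l * gaussSmooth σ f x := by
  have hint : Integrable (fun y ↦ f (x + σ • y)) (stdGaussian E) :=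
    integrable_of_forall_mem_Icc (by fun_prop) fun y ↦ hf01 (x + σ • y)
  rw [gaussSmooth, integral_add (integrable_const k) (hint.const_mul l), integral_const_mul]
  simp [gaussSmooth]

lemma gaussSmooth_le_add_of_forall_le {σ e : ℝ} {f g : E → ℝ} (hf : Measurable f)
    (hg : Measurable g) (hf01 : ∀ x, f x ∈ Icc 0 1) (hg01 : ∀ x, g x ∈ Icc 0 1)
    (hle : ∀ x, f x ≤ g x + e) (x : E) :
    gaussSmooth σ f x ≤ gaussSmooth σ g x + e := by
  have hfi : Integrable (fun y ↦ f (x + σ • y)) (stdGaussian E) :=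
    integrable_of_forall_mem_Icc (by fun_prop) fun y ↦ hf01 (x + σ • y)
  have hgi : Integrable (fun y ↦ g (x + σ • y)) (stdGaussian E) :=
    integrable_of_forall_mem_Icc (by fun_prop) fun y ↦ hg01 (x + σ • y)
  calc gaussSmooth σ f x
      ≤ ∫ y, (g (x + σ • y) + e) ∂stdGaussian E :=
        integral_mono hfi (hgi.add (integrable_const e)) fun y ↦ hle (x + σ • y)
    _ = gaussSmooth σ g x + e := by
        rw [integral_add hgi (integrable_const e)]
        simp [gaussSmooth]

lemma gaussShift_gaussSmooth_le_rescale {c c' b h e : ℝ} {s : Set ℝ}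
    (hstep : ∀ f : E → ℝ, Measurable f → (∀ x, f x ∈ s) →
      gaussShift c' (gaussSmooth b f 0)
        ≤ gaussSmooth h (fun z ↦ gaussShift c (gaussSmooth 1 f z)) 0 + e)
    (σ : ℝ) {f : E → ℝ} (hf : Measurable f) (hfs : ∀ x, f x ∈ s) (x : E) :
    gaussShift c' (gaussSmooth (σ * b) f x)
      ≤ gaussSmooth (σ * h) (fun z ↦ gaussShift c (gaussSmooth σ f z)) x + e := by
  have hle := hstep (fun y ↦ f (x + σ • y)) (by fun_prop) fun y ↦ hfs (x + σ • y)
  have hshift := gaussSmooth_comp_add_smul σ h (fun z ↦ gaussShift c (gaussSmooth σ f z)) x 0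
  simp_rw [gaussSmooth_comp_add_smul, mul_one] at hle
  rwa [hshift, smul_zero, add_zero] at hle

lemma gaussShift_gaussSmooth_iterate {C e h : ℝ} {s : Set ℝ}
    (hstep : ∀ c ∈ Icc 0 C, ∀ f : E → ℝ, Measurable f → (∀ x, f x ∈ s) →
      gaussShift (c / √(1 + h ^ 2)) (gaussSmooth √(1 + h ^ 2) f 0)
        ≤ gaussSmooth h (fun z ↦ gaussShift c (gaussSmooth 1 f z)) 0 + e)
    (n : ℕ) {c : ℝ} (hc : c ∈ Icc 0 C) {f : E → ℝ} (hf : Measurable f) (hfs : ∀ x, f x ∈ s)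
    (x : E) :
    gaussShift (c / √(1 + h ^ 2) ^ n) (gaussSmooth (√(1 + h ^ 2) ^ n) f x)
      ≤ gaussSmooth √((√(1 + h ^ 2) ^ n) ^ 2 - 1) (fun z ↦ gaussShift c (gaussSmooth 1 f z)) x
        + n * e := by
  have ht : 1 ≤ √(1 + h ^ 2) := Real.one_le_sqrt.2 (le_add_of_nonneg_right (sq_nonneg h))
  have ht_sq : √(1 + h ^ 2) ^ 2 = 1 + h ^ 2 := Real.sq_sqrt (by positivity)
  set t := √(1 + h ^ 2)
  have hG := measurable_gaussShift_gaussSmooth c 1 hf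
  have hG01 (z : E) : gaussShift c (gaussSmooth 1 f z) ∈ Icc 0 1 := gaussShift_mem_Icc c _
  induction n generalizing x with
  | zero => simp [gaussSmooth]
  | succ n ih =>
    have htn : 1 ≤ t ^ n := one_le_pow₀ ht
    have hcn : c / t ^ n ∈ Icc 0 C :=
      ⟨div_nonneg hc.1 (by positivity), (div_le_self hc.1 htn).trans hc.2⟩
    have hlast := gaussShift_gaussSmooth_le_rescale (hstep _ hcn) (t ^ n) hf hfs x
    have hfirst := gaussSmooth_le_add_of_forall_le (σ := t ^ n * h)
      (measurable_gaussShift_gaussSmooth _ _ hf) (measurable_gaussSmooth _ hG)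
      (fun z ↦ gaussShift_mem_Icc _ _) (gaussSmooth_mem_Icc _ hG hG01) ih x
    have hvar : (t ^ n * h) ^ 2 + √((t ^ n) ^ 2 - 1) ^ 2 = (t ^ (n + 1)) ^ 2 - 1 := by
      rw [Real.sq_sqrt (sub_nonneg.2 (one_le_pow₀ htn)), pow_succ t n, mul_pow, mul_pow, ht_sq]
      ring
    rw [gaussSmooth_gaussSmooth _ _ hG hG01, hvar] at hfirst
    rw [div_div, ← pow_succ] at hlast
    push_cast
    linarith

lemma exists_tendsto_zero_sqrt_one_add_sq_pow_eq {b : ℝ} (hb : 1 ≤ b) :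
    ∃ h : ℕ → ℝ, (∀ n, 0 ≤ h n) ∧ Tendsto h atTop (𝓝 0) ∧
      ∀ n ≠ 0, √(1 + h n ^ 2) ^ n = b ∧ n * h n ^ 2 ≤ b ^ 2 - 1 := by
  have hb_pos : 0 < b := one_pos.trans_le hb
  have ht (n : ℕ) : 1 ≤ b ^ (n : ℝ)⁻¹ := Real.one_le_rpow hb (by positivity)
  have hsq (n : ℕ) : √((b ^ (n : ℝ)⁻¹) ^ 2 - 1) ^ 2 = (b ^ (n : ℝ)⁻¹) ^ 2 - 1 :=
    Real.sq_sqrt (sub_nonneg.2 (one_le_pow₀ (ht n)))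
  refine ⟨fun n ↦ √((b ^ (n : ℝ)⁻¹) ^ 2 - 1), fun n ↦ Real.sqrt_nonneg _, ?_, fun n hn ↦ ?_⟩
  · have hlim : Tendsto (fun n : ℕ ↦ b ^ (n : ℝ)⁻¹) atTop (𝓝 (b ^ (0 : ℝ))) :=
      (Real.continuousAt_const_rpow hb_pos.ne').tendsto.comp tendsto_inv_atTop_nhds_zero_nat
    simpa using ((hlim.pow 2).sub_const 1).sqrt
  · have hpow : (b ^ (n : ℝ)⁻¹) ^ n = b := Real.rpow_inv_natCast_pow hb_pos.le hn
    refine ⟨?_, ?_⟩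
    · rw [hsq, add_sub_cancel, Real.sqrt_sq (by positivity), hpow]
    · have hbernoulli := one_add_mul_sub_le_pow
        (show -1 ≤ (b ^ (n : ℝ)⁻¹) ^ 2 by linarith [sq_nonneg (b ^ (n : ℝ)⁻¹)]) n
      rw [pow_right_comm, hpow] at hbernoulli
      rw [hsq]
      linarith

lemma gaussShift_gaussSmooth_le_of_forall_mem_Icc {c b M : ℝ} (hc : 0 ≤ c) (hb : 1 ≤ b)
    {f : E → ℝ} (hf : Measurable f) (hfM : ∀ x, f x ∈ Icc (gaussCDF (-M : ℝ)) (gaussCDF M)) :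
    gaussShift (c / b) (gaussSmooth b f 0)
      ≤ gaussSmooth √(b ^ 2 - 1) (fun z ↦ gaussShift c (gaussSmooth 1 f z)) 0 := by
  obtain ⟨K, hK⟩ := exists_gaussSmooth_step E c M
  obtain ⟨h, hh_nonneg, hh_lim, hh⟩ := exists_tendsto_zero_sqrt_one_add_sq_pow_eq hb
  have hbound : ∀ᶠ n in atTop, gaussShift (c / b) (gaussSmooth b f 0)
      ≤ gaussSmooth √(b ^ 2 - 1) (fun z ↦ gaussShift c (gaussSmooth 1 f z)) 0
        + |K| * (b ^ 2 - 1) * h n := by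
    filter_upwards [eventually_ne_atTop 0, hh_lim.eventually_le_const one_pos] with n hn hn_le
    obtain ⟨hpow, hsum⟩ := hh n hn
    have hiter := gaussShift_gaussSmooth_iterate (hK (h n) ⟨hh_nonneg n, hn_le⟩) n
      ⟨hc, le_rfl⟩ hf hfM 0
    rw [hpow] at hiter
    refine hiter.trans (add_le_add_right ?_ _)
    calc n * (K * h n ^ 3) ≤ n * (|K| * h n ^ 3) := by
          have := hh_nonneg n
          gcongr
          exact le_abs_self K
      _ = |K| * (n * h n ^ 2) * h n := by ring
      _ ≤ |K| * (b ^ 2 - 1) * h n := by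
          have := hh_nonneg n
          gcongr
  refine ge_of_tendsto ?_ hbound
  simpa using (hh_lim.const_mul (|K| * (b ^ 2 - 1))).const_add
    (gaussSmooth √(b ^ 2 - 1) (fun z ↦ gaussShift c (gaussSmooth 1 f z)) (0 : E))

lemma tendsto_gaussSmooth_gaussShift {c σ : ℝ} {q : ℕ → E → ℝ} {q₀ : E → ℝ}
    (hq : ∀ n, Measurable (q n)) (hlim : ∀ x, Tendsto (fun n ↦ q n x) atTop (𝓝 (q₀ x))) (x : E) :
    Tendsto (fun n ↦ gaussSmooth σ (fun z ↦ gaussShift c (q n z)) x) atTop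
      (𝓝 (gaussSmooth σ (fun z ↦ gaussShift c (q₀ z)) x)) :=
  tendsto_integral_of_dominated_convergence (fun _ ↦ 1)
    (fun n ↦ ((gaussShift_mono c).measurable.comp
      ((hq n).comp (by fun_prop))).aestronglyMeasurable)
    (integrable_const 1)
    (fun n ↦ ae_of_all _ fun y ↦ norm_le_one_of_mem_Icc (gaussShift_mem_Icc c _))
    (ae_of_all _ fun y ↦ ((continuous_gaussShift c).tendsto _).comp (hlim _))

lemma gaussShift_gaussSmooth_le {c b : ℝ} (hc : 0 ≤ c) (hb : 1 ≤ b) {f : E → ℝ}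
    (hf : Measurable f) (hf01 : ∀ x, f x ∈ Icc 0 1) :
    gaussShift (c / b) (gaussSmooth b f 0)
      ≤ gaussSmooth √(b ^ 2 - 1) (fun z ↦ gaussShift c (gaussSmooth 1 f z)) 0 := by
  let k (n : ℕ) : ℝ := gaussCDF (-(n : ℝ) : ℝ)
  let l (n : ℕ) : ℝ := gaussCDF (n : ℝ) - k n
  have hk : Tendsto k atTop (𝓝 0) :=
    tendsto_gaussCDF_atBot.comp (tendsto_neg_atTop_atBot.comp tendsto_natCast_atTop_atTop)
  have hl : Tendsto l atTop (𝓝 1) := by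
    rw [← sub_zero (1 : ℝ)]
    exact (tendsto_gaussCDF_atTop.comp tendsto_natCast_atTop_atTop).sub hk
  have hl_nonneg (n : ℕ) : 0 ≤ l n :=
    sub_nonneg.2 (strictMono_gaussCDF_coe.monotone (neg_le_self n.cast_nonneg))
  have hf_meas (n : ℕ) : Measurable fun y ↦ k n + l n * f y := by fun_prop
  have hf_mem (n : ℕ) (x : E) :
      k n + l n * f x ∈ Icc (gaussCDF (-(n : ℝ) : ℝ)) (gaussCDF (n : ℝ)) :=
    ⟨le_add_of_nonneg_right (mul_nonneg (hl_nonneg n) (hf01 x).1),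
      le_sub_iff_add_le'.1 (mul_le_of_le_one_right (hl_nonneg n) (hf01 x).2)⟩
  have hlim (σ : ℝ) (x : E) : Tendsto (fun n ↦ gaussSmooth σ (fun y ↦ k n + l n * f y) x) atTop
      (𝓝 (gaussSmooth σ f x)) := by
    simp_rw [gaussSmooth_const_add_mul σ _ _ hf hf01]
    simpa using hk.add (hl.mul_const (gaussSmooth σ f x))
  exact le_of_tendsto_of_tendsto' (((continuous_gaussShift _).tendsto _).comp (hlim b 0))
    (tendsto_gaussSmooth_gaussShift (fun n ↦ measurable_gaussSmooth 1 (hf_meas n)) (hlim 1) 0)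
    fun n ↦ gaussShift_gaussSmooth_le_of_forall_mem_Icc hc hb (hf_meas n) (hf_mem n)

lemma gaussShift_integral_le {t b : ℝ} (ht : 0 ≤ t) (hb : 1 ≤ b) {f : E → ℝ}
    (hf : Measurable f) (hf01 : ∀ x, f x ∈ Icc 0 1) :
    gaussShift t (∫ y, f y ∂stdGaussian E)
      ≤ ∫ y, gaussShift (t * b) (gaussSmooth b⁻¹ f (√(1 - b⁻¹ ^ 2) • y)) ∂stdGaussian E := by
  have hb_pos : 0 < b := one_pos.trans_le hb
  have hle := gaussShift_gaussSmooth_le_rescale (E := E) (e := 0) (fun f hf hf01 ↦ by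
    simpa using gaussShift_gaussSmooth_le (mul_nonneg ht hb_pos.le) hb hf hf01) b⁻¹ hf hf01 0
  have hscale : b⁻¹ * √(b ^ 2 - 1) = √(1 - b⁻¹ ^ 2) := by
    rw [← Real.sqrt_sq (inv_nonneg.2 hb_pos.le), ← Real.sqrt_mul (sq_nonneg _),
      Real.sqrt_sq (inv_nonneg.2 hb_pos.le)]
    congr 1
    field_simp
  rw [mul_div_cancel_right₀ t hb_pos.ne', inv_mul_cancel₀ hb_pos.ne', hscale] at hle
  simpa [gaussSmooth] using hle

/-! ### The Gaussian isoperimetric inequality -/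

lemma integrable_exp_mul_sq_gaussianReal {β : ℝ} (hβ : β < 1) :
    Integrable (fun x : ℝ ↦ Real.exp (β * x ^ 2 / 2)) (gaussianReal 0 1) := by
  rw [gaussianReal_of_var_ne_zero 0 one_ne_zero, integrable_withDensity_iff_integrable_smul'
    (measurable_gaussianPDF 0 1) (ae_of_all _ fun _ ↦ gaussianPDF_lt_top)]
  refine ((integrable_exp_neg_mul_sq (b := (1 - β) / 2) (by linarith)).const_mul
    (√(2 * Real.pi))⁻¹).congr (ae_of_all _ fun x ↦ ?_)
  simp only [toReal_gaussianPDF, smul_eq_mul]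
  change _ = gaussPDF x * _
  rw [gaussPDF_eq, mul_assoc, ← Real.exp_add]
  congr 2
  ring

lemma integrable_exp_mul_norm_sq_stdGaussian {β : ℝ} (hβ : β < 1) :
    Integrable (fun x : E ↦ Real.exp (β * ‖x‖ ^ 2 / 2)) (stdGaussian E) := by
  rw [stdGaussian, integrable_map_measure (Measurable.aestronglyMeasurable (by fun_prop))
    (Measurable.aemeasurable (by fun_prop))]
  refine (Integrable.fintype_prod (f := fun _ x ↦ Real.exp (β * x ^ 2 / 2))
    fun _ ↦ integrable_exp_mul_sq_gaussianReal hβ).congr (ae_of_all _ fun x ↦ ?_)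
  simp only [Function.comp_apply]
  rw [← Real.exp_sum, ← (stdOrthonormalBasis ℝ E).sum_sq_norm_inner_right, ← Finset.sum_div,
    ← Finset.mul_sum]
  congr 3
  refine Finset.sum_congr rfl fun i _ ↦ ?_
  rw [inner_sum]
  simp [inner_smul_right, OrthonormalBasis.inner_eq_ite]

lemma measureReal_le_norm_stdGaussian_le {β : ℝ} (hβ : β ∈ Ico (0 : ℝ) 1) {R : ℝ} (hR : 0 ≤ R) :
    (stdGaussian E).real {y | R ≤ ‖y‖}
      ≤ (∫ x : E, Real.exp (β * ‖x‖ ^ 2 / 2) ∂stdGaussian E) * Real.exp (-(β * R ^ 2 / 2)) := by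
  have hmarkov := mul_meas_ge_le_integral_of_nonneg (ae_of_all _ fun x ↦ (Real.exp_pos _).le)
    (integrable_exp_mul_norm_sq_stdGaussian (E := E) hβ.2) (Real.exp (β * R ^ 2 / 2))
  have hsub : {y : E | R ≤ ‖y‖} ⊆
      {y | Real.exp (β * R ^ 2 / 2) ≤ Real.exp (β * ‖y‖ ^ 2 / 2)} := fun y (hy : R ≤ ‖y‖) ↦ by
    have := hβ.1
    simp only [mem_ofPred_eq]
    gcongr
  rw [Real.exp_neg, ← div_eq_mul_inv, le_div_iff₀ (Real.exp_pos _), mul_comm]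
  exact (mul_le_mul_of_nonneg_left (measureReal_mono hsub) (Real.exp_pos _).le).trans hmarkov

lemma gaussPDF_add_one_le_gaussCDF_neg {u : ℝ} (hu : 0 ≤ u) :
    gaussPDF (u + 1) ≤ gaussCDF (-u : ℝ) := by
  obtain ⟨ξ, hξ, hslope⟩ := exists_hasDerivAt_eq_slope (fun x : ℝ ↦ gaussCDF x) gaussPDF
    (sub_one_lt (-u)) continuous_gaussCDF_coe.continuousOn fun x _ ↦ hasDerivAt_gaussCDF x
  have hle : gaussPDF (u + 1) ≤ gaussPDF ξ := gaussPDF_le_gaussPDF <| by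
    rw [abs_of_neg (by linarith [hξ.2]), abs_of_pos (by linarith)]
    linarith [hξ.1]
  rw [hslope, sub_sub_cancel, div_one] at hle
  linarith [gaussCDF_nonneg ((-u - 1 : ℝ) : EReal)]

lemma eventually_mul_exp_neg_sq_le_gaussPDF {s t : ℝ} (hst : t ^ 2 < s) (K N : ℝ) :
    ∀ᶠ b : ℝ in atTop, K * Real.exp (-(s * b ^ 2 / 2)) ≤ gaussPDF (N + t * b) := by
  have hlim : Tendsto (fun b : ℝ ↦ b * ((s - t ^ 2) / 2 * b - t * N) - N ^ 2 / 2)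
      atTop atTop := by
    refine tendsto_atTop_add_const_right _ _ (tendsto_id.atTop_mul_atTop₀ ?_)
    exact tendsto_atTop_add_const_right _ _
      (tendsto_id.const_mul_atTop (half_pos (sub_pos.2 hst)))
  filter_upwards [(Real.tendsto_exp_atTop.comp hlim).eventually_ge_atTop (K * √(2 * Real.pi))]
    with b hb
  rw [gaussPDF_eq, ← div_eq_inv_mul, le_div_iff₀ (by positivity), mul_right_comm]
  refine (mul_le_mul_of_nonneg_right hb (Real.exp_pos _).le).trans_eq ?_
  rw [Function.comp_apply, ← Real.exp_add]
  congr 1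
  ring

lemma eventually_measureReal_le_norm_le_gaussCDF (E : Type*) [NormedAddCommGroup E]
    [InnerProductSpace ℝ E] [FiniteDimensional ℝ E] [MeasurableSpace E] [BorelSpace E]
    {t ρ N : ℝ} (ht : 0 ≤ t) (htρ : t < ρ) (hN : 0 ≤ N) :
    ∀ᶠ b : ℝ in atTop, (stdGaussian E).real {y | ρ * b ≤ ‖y‖} ≤ gaussCDF (-(N + t * b) : ℝ) := by
  have hρ : 0 < ρ := ht.trans_lt htρ
  have hratio : t ^ 2 / ρ ^ 2 < 1 :=
    (div_lt_one (by positivity)).2 (pow_lt_pow_left₀ htρ ht two_ne_zero)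
  obtain ⟨β, hβ, hβ_lt⟩ := exists_between hratio
  have hβ_nonneg : 0 ≤ β := (by positivity : 0 ≤ t ^ 2 / ρ ^ 2).trans hβ.le
  filter_upwards [eventually_mul_exp_neg_sq_le_gaussPDF ((div_lt_iff₀ (by positivity)).1 hβ)
    (∫ x : E, Real.exp (β * ‖x‖ ^ 2 / 2) ∂stdGaussian E) (N + 1), eventually_ge_atTop 0]
    with b hb hb_nonneg
  calc (stdGaussian E).real {y | ρ * b ≤ ‖y‖}
      ≤ (∫ x : E, Real.exp (β * ‖x‖ ^ 2 / 2) ∂stdGaussian E)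
          * Real.exp (-(β * (ρ * b) ^ 2 / 2)) :=
        measureReal_le_norm_stdGaussian_le ⟨hβ_nonneg, hβ_lt⟩ (by positivity)
    _ ≤ gaussPDF (N + t * b + 1) := by rwa [mul_pow, ← mul_assoc, add_right_comm]
    _ ≤ gaussCDF (-(N + t * b) : ℝ) := gaussPDF_add_one_le_gaussCDF_neg (by positivity)

lemma indicator_one_mem_Icc {α : Type*} (A : Set α) (x : α) :
    A.indicator (1 : α → ℝ) x ∈ Icc 0 1 :=
  ⟨indicator_nonneg (fun _ _ ↦ zero_le_one) x, indicator_le_self' (fun _ _ ↦ zero_le_one) x⟩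

lemma gaussSmooth_indicator_one (σ : ℝ) {A : Set E} (hA : MeasurableSet A) (x : E) :
    gaussSmooth σ (A.indicator 1) x = (stdGaussian E).real {y | x + σ • y ∈ A} := by
  have hpre : MeasurableSet ((fun y ↦ x + σ • y) ⁻¹' A) := hA.preimage (by fun_prop)
  exact integral_indicator_one hpre

lemma gaussSmooth_inv_indicator_one_le {A : Set E} (hA : MeasurableSet A) {b ρ : ℝ} (hb : 0 < b)
    {x : E} (hx : x ∉ Metric.cthickening ρ A) :
    gaussSmooth b⁻¹ (A.indicator 1) x ≤ (stdGaussian E).real {y | ρ * b ≤ ‖y‖} := by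
  rw [gaussSmooth_indicator_one _ hA]
  refine measureReal_mono fun y (hy : x + b⁻¹ • y ∈ A) ↦ ?_
  have hdist : ρ < dist x (x + b⁻¹ • y) :=
    lt_of_not_ge fun hle ↦ hx (Metric.mem_cthickening_of_dist_le _ _ _ _ hy hle)
  rw [dist_self_add_right, norm_smul, Real.norm_eq_abs, abs_of_pos (inv_pos.2 hb),
    ← div_eq_inv_mul, lt_div_iff₀ hb] at hdist
  exact hdist.le

lemma tendsto_gaussShift_gaussSmooth_indicator_one {A : Set E} (hA : MeasurableSet A) {t ρ : ℝ}
    (ht : 0 ≤ t) (htρ : t < ρ) {y : E} (hy : y ∉ Metric.cthickening ρ A) :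
    Tendsto (fun n : ℕ ↦ gaussShift (t * n)
      (gaussSmooth (n : ℝ)⁻¹ (A.indicator 1) (√(1 - (n : ℝ)⁻¹ ^ 2) • y))) atTop (𝓝 0) := by
  have hscale : Tendsto (fun n : ℕ ↦ √(1 - (n : ℝ)⁻¹ ^ 2) • y) atTop (𝓝 y) := by
    have hsqrt : Tendsto (fun n : ℕ ↦ √(1 - (n : ℝ)⁻¹ ^ 2)) atTop (𝓝 1) := by
      simpa using (((tendsto_inv_atTop_nhds_zero_nat (𝕜 := ℝ)).pow 2).const_sub 1).sqrt
    simpa using hsqrt.smul_const y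
  have houtside := hscale.eventually (Metric.isClosed_cthickening.isOpen_compl.mem_nhds hy)
  refine tendsto_order.2 ⟨fun a ha ↦ Eventually.of_forall fun n ↦
    ha.trans_le (gaussShift_mem_Icc _ _).1, fun a ha ↦ ?_⟩
  obtain ⟨N, hNa, hN⟩ := (((tendsto_gaussCDF_atBot.comp
    tendsto_neg_atTop_atBot).eventually_lt_const ha).and (eventually_ge_atTop 0)).exists
  filter_upwards [houtside, eventually_gt_atTop 0, tendsto_natCast_atTop_atTop.eventually
    (eventually_measureReal_le_norm_le_gaussCDF E ht htρ hN)] with n hn_outside hn htail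
  calc gaussShift (t * n)
        (gaussSmooth (n : ℝ)⁻¹ (A.indicator 1) (√(1 - (n : ℝ)⁻¹ ^ 2) • y))
      ≤ gaussShift (t * n) (gaussCDF (-(N + t * n) : ℝ)) := gaussShift_mono _ <|
        (gaussSmooth_inv_indicator_one_le hA (Nat.cast_pos.2 hn) hn_outside).trans htail
    _ = gaussCDF (-N : ℝ) := by rw [gaussShift_gaussCDF, neg_add, neg_add_cancel_right]
    _ < a := hNa

lemma gaussShift_le_measureReal_cthickening {A : Set E} (hA : MeasurableSet A) {t ρ : ℝ}
    (ht : 0 ≤ t) (htρ : t < ρ) :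
    gaussShift t ((stdGaussian E).real A) ≤ (stdGaussian E).real (Metric.cthickening ρ A) := by
  have hind : Measurable (A.indicator (1 : E → ℝ)) := measurable_one.indicator hA
  refine le_measureReal_of_eventually_le_integral Metric.isClosed_cthickening.measurableSet
    (fun n ↦ (measurable_gaussShift_gaussSmooth (t * n) (n : ℝ)⁻¹ hind).comp
      (measurable_const_smul √(1 - (n : ℝ)⁻¹ ^ 2)))
    (fun n y ↦ gaussShift_mem_Icc _ _)
    (fun y hy ↦ tendsto_gaussShift_gaussSmooth_indicator_one hA ht htρ hy) ?_
  filter_upwards [eventually_ge_atTop 1] with n hn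
  rw [← integral_indicator_one hA]
  exact gaussShift_integral_le ht (Nat.one_le_cast.2 hn) hind (indicator_one_mem_Icc A)

theorem gaussShift_le_measureReal_thickening (A : Set E) {t : ℝ} (ht : 0 < t) :
    gaussShift t ((stdGaussian E).real A) ≤ (stdGaussian E).real (Metric.thickening t A) := by
  rw [← Metric.thickening_closure]
  refine (gaussShift_mono t (measureReal_mono subset_closure)).trans ?_
  have hle : ∀ᶠ s in 𝓝[<] t, gaussShift s ((stdGaussian E).real (closure A))
      ≤ (stdGaussian E).real (Metric.thickening t (closure A)) := by
    filter_upwards [Ioo_mem_nhdsLT ht] with s hs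
    obtain ⟨ρ, hsρ, hρt⟩ := exists_between hs.2
    exact (gaussShift_le_measureReal_cthickening isClosed_closure.measurableSet hs.1.le hsρ).trans
      (measureReal_mono (Metric.cthickening_subset_thickening' ht hρt (closure A)))
  exact le_of_tendsto (continuous_gaussShift_left _).continuousWithinAt hle

end StdGaussian

/-! ### Adversarial risk under a generative model -/

section Robustness

lemma measureReal_sub_le_measureReal_inter {α : Type*} [MeasurableSpace α] {ν : Measure α}
    [IsProbabilityMeasure ν] {A G : Set α} (hA : MeasurableSet A) {δ : ℝ} (hG : 1 - δ ≤ ν.real G) :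
    ν.real A - δ ≤ ν.real (G ∩ A) := by
  have hsplit := measureReal_inter_add_sdiff (μ := ν) (s := G) hA
  have hdiff : ν.real (G \ A) ≤ ν.real Aᶜ := measureReal_mono fun x hx ↦ hx.2
  rw [probReal_compl_eq_one_sub hA] at hdiff
  linarith

variable {X : Type*} {K d : ℕ}

lemma LocallyLipschitzWithProb.mono [MetricSpace X] {g : EuclideanSpace ℝ (Fin d) → X}
    {r L L' δ : ℝ} (hg : LocallyLipschitzWithProb g r L δ) (hL : L ≤ L') :
    LocallyLipschitzWithProb g r L' δ :=
  le_trans hg <| measureReal_mono fun _ hz z' hz' ↦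
    (hz z' hz').trans (mul_le_mul_of_nonneg_right hL (norm_nonneg _))

variable [MeasurableSpace X]

lemma LocallyLipschitzWithProb.gaussShift_sub_le [MetricSpace X]
    {g : EuclideanSpace ℝ (Fin d) → X} {r L δ ε : ℝ} (hgL : LocallyLipschitzWithProb g r L δ)
    (hg : Measurable g) (hL : 0 < L) (hε : 0 < ε) (hrL : ε ≤ r * L) {B : Set X}
    (hB : MeasurableSet B) :
    gaussShift (ε / L) ((condLaw g).real B) - δ
      ≤ (condLaw g).real {x | ∃ x' ∈ Metric.closedBall x ε, x' ∈ B} := by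
  set S := {x | ∃ x' ∈ Metric.closedBall x ε, x' ∈ B}
  set T := Metric.thickening (ε / L) (g ⁻¹' B)
  set G := {z | ∀ z' ∈ Metric.closedBall z r, dist (g z') (g z) ≤ L * ‖z' - z‖}
  have : IsProbabilityMeasure (condLaw g) := Measure.isProbabilityMeasure_map hg.aemeasurable
  have hsub : G ∩ T ⊆ g ⁻¹' S := by
    rintro z ⟨hz, hzT⟩
    obtain ⟨z', hz'B, hzz'⟩ := Metric.mem_thickening_iff.1 hzT
    have hdist : dist z' z * L ≤ ε := (le_div_iff₀ hL).1 (dist_comm z z' ▸ hzz'.le)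
    refine ⟨g z', (hz z' (le_of_mul_le_mul_right (hdist.trans hrL) hL)).trans ?_, hz'B⟩
    rwa [← dist_eq_norm, mul_comm]
  calc gaussShift (ε / L) ((condLaw g).real B) - δ
      = gaussShift (ε / L) ((latentLaw d).real (g ⁻¹' B)) - δ := by
        rw [condLaw, map_measureReal_apply hg hB]
    _ ≤ (latentLaw d).real T - δ :=
        sub_le_sub_right (gaussShift_le_measureReal_thickening _ (div_pos hε hL)) δ
    _ ≤ (latentLaw d).real (G ∩ T) :=
        measureReal_sub_le_measureReal_inter Metric.isOpen_thickening.measurableSet hgL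
    _ ≤ (latentLaw d).real (g ⁻¹' S) := measureReal_mono hsub
    _ ≤ (condLaw g).real S :=
        ENNReal.toReal_mono (measure_ne_top _ S) (Measure.le_map_apply hg.aemeasurable S)

lemma IsGeneratedBy.measureReal_eq {μ : Measure X} {g : Fin K → EuclideanSpace ℝ (Fin d) → X}
    {p : Fin K → ℝ} (hμ : IsGeneratedBy μ g p) (S : Set X) :
    μ.real S = ∑ i, p i * (condLaw (g i)).real S := by
  have hprob (i : Fin K) : IsProbabilityMeasure (condLaw (g i)) :=
    Measure.isProbabilityMeasure_map (hμ.measurable i).aemeasurable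
  rw [measureReal_def, hμ.eq_mixture, Measure.finsetSum_apply]
  simp_rw [Measure.smul_apply, smul_eq_mul]
  rw [ENNReal.toReal_sum fun i _ ↦ ENNReal.mul_ne_top ENNReal.ofReal_ne_top (measure_ne_top _ S)]
  simp_rw [ENNReal.toReal_mul, ENNReal.toReal_ofReal (hμ.nonneg _), measureReal_def]

lemma IsGeneratedBy.sum_gaussShift_sub_le_advRisk [MetricSpace X] {μ : Measure X}
    {g : Fin K → EuclideanSpace ℝ (Fin d) → X} {p : Fin K → ℝ} (hμ : IsGeneratedBy μ g p)
    {r L δ ε : ℝ} (hg : ∀ i, LocallyLipschitzWithProb (g i) r L δ) (hL : 0 < L) (hε : 0 < ε)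
    (hrL : ε ≤ r * L) {fstar f : X → Fin K} (hfstar : Measurable fstar) (hf : Measurable f) :
    ∑ i, p i * gaussShift (ε / L) (risk (condLaw (g i)) fstar f) - δ ≤ advRisk μ fstar ε f := by
  have hB : MeasurableSet {x | f x ≠ fstar x} := (measurableSet_eq_fun hf hfstar).compl
  calc ∑ i, p i * gaussShift (ε / L) (risk (condLaw (g i)) fstar f) - δ
      = ∑ i, p i * (gaussShift (ε / L) (risk (condLaw (g i)) fstar f) - δ) := by
        simp_rw [mul_sub, Finset.sum_sub_distrib, ← Finset.sum_mul, hμ.sum_eq_one, one_mul]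
    _ ≤ ∑ i, p i * advRisk (condLaw (g i)) fstar ε f := Finset.sum_le_sum fun i _ ↦
        mul_le_mul_of_nonneg_left ((hg i).gaussShift_sub_le (hμ.measurable i) hL hε hrL hB)
          (hμ.nonneg i)
    _ = advRisk μ fstar ε f := (hμ.measureReal_eq _).symm

lemma intrinsicRob_le [MetricSpace X] {μ : Measure X} {fstar : X → Fin K} {ε δ b : ℝ}
    {F : Set (X → Fin K)} (hF : ∀ f ∈ F, b - δ ≤ advRisk μ fstar ε f) :
    intrinsicRob μ fstar ε F ≤ ((1 + δ - b : ℝ) : EReal) := by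
  have hle : ((b - δ : ℝ) : EReal) ≤ ⨅ f ∈ F, (advRisk μ fstar ε f : EReal) :=
    le_iInf₂ fun f hf ↦ EReal.coe_le_coe_iff.2 (hF f hf)
  refine (EReal.sub_le_sub le_rfl hle).trans_eq ?_
  rw [← EReal.coe_one, ← EReal.coe_sub, ← sub_add, add_sub_right_comm]

lemma iInf_mul_gaussShift_le_sum {ι : Type*} [Fintype ι] {c α : ℝ} (hc : 0 ≤ c) (hα : 0 < α)
    {p a : ι → ℝ} (hp : ∀ i, 0 < p i ∧ α / p i ≤ 1) (ha : ∀ i, 0 ≤ a i)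
    (hsum : α ≤ ∑ i, p i * a i) :
    ⨅ i, p i * gaussShift c (α / p i) ≤ ∑ i, p i * gaussShift c (a i) := by
  have hm_le (i : ι) : ⨅ i, p i * gaussShift c (α / p i) ≤ p i * gaussShift c (α / p i) :=
    ciInf_le (finite_range _).bddBelow i
  have hterm (b : ι → ℝ) (i : ι) : 0 ≤ p i * gaussShift c (b i) :=
    mul_nonneg (hp i).1.le (gaussShift_mem_Icc _ _).1
  have hm : 0 ≤ ⨅ i, p i * gaussShift c (α / p i) := Real.iInf_nonneg (hterm _)
  set m := ⨅ i, p i * gaussShift c (α / p i)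
  rcases em (∃ i, α ≤ p i * a i) with ⟨i, hi⟩ | hlt
  · calc m ≤ p i * gaussShift c (α / p i) := hm_le i
      _ ≤ p i * gaussShift c (a i) := mul_le_mul_of_nonneg_left
          (gaussShift_mono c ((div_le_iff₀' (hp i).1).2 hi)) (hp i).1.le
      _ ≤ ∑ i, p i * gaussShift c (a i) :=
          Finset.single_le_sum (fun j _ ↦ hterm a j) (Finset.mem_univ i)
  · push Not at hlt
    have hshare (i : ι) : p i * a i / α * m ≤ p i * gaussShift c (a i) := by
      have hpi := (hp i).1
      have hl : p i * a i / α ∈ Icc (0 : ℝ) 1 :=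
        ⟨div_nonneg (mul_nonneg hpi.le (ha i)) hα.le, (div_le_one hα).2 (hlt i).le⟩
      calc p i * a i / α * m ≤ p i * a i / α * (p i * gaussShift c (α / p i)) :=
            mul_le_mul_of_nonneg_left (hm_le i) hl.1
        _ = p i * (p i * a i / α * gaussShift c (α / p i)) := mul_left_comm _ _ _
        _ ≤ p i * gaussShift c (p i * a i / α * (α / p i)) := mul_le_mul_of_nonneg_left
            (mul_gaussShift_le hc hl ⟨div_nonneg hα.le hpi.le, (hp i).2⟩) hpi.le
        _ = p i * gaussShift c (a i) := by
            congr 2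
            field_simp
    calc m ≤ (∑ i, p i * a i) / α * m := le_mul_of_one_le_left hm ((one_le_div hα).2 hsum)
      _ = ∑ i, p i * a i / α * m := by rw [Finset.sum_div, Finset.sum_mul]
      _ ≤ ∑ i, p i * gaussShift c (a i) := Finset.sum_le_sum fun i _ ↦ hshare i

end Robustness

end IntrinsicRobustness

end

theorem theorem2 {X : Type*} [MetricSpace X] [MeasurableSpace X] {K d : ℕ}
    (μ : Measure X) [IsProbabilityMeasure μ]
    (fstar : X → Fin K) (hfstar : Measurable fstar)
    (g : Fin K → EuclideanSpace ℝ (Fin d) → X) (p : Fin K → ℝ)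
    (hμ : IntrinsicRobustness.IsGeneratedBy μ g p)
    (ε r δ : ℝ) (hε : 0 < ε) (hr : 0 < r) (hδ : 0 < δ) (hδ1 : δ ≤ 1)
    (L : Fin K → ℝ)
    (hL : ∀ i, IntrinsicRobustness.LocallyLipschitzWithProb (g i) r (L i) δ)
    (hrL : ∀ i, ε ≤ r * L i)
    (α : ℝ) (hα : 0 < α) :
    ((∀ i, 0 < p i ∧ α / p i ≤ 1) →
      IntrinsicRobustness.intrinsicRob μ fstar ε (IntrinsicRobustness.imperfect μ fstar α) ≤
        ((1 + δ - ⨅ i, p i * IntrinsicRobustness.gaussCDF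
          (IntrinsicRobustness.gaussQuantile (α / p i) + ((ε / ⨆ j, L j : ℝ) : EReal)) : ℝ) :
            EReal)) ∧
    IntrinsicRobustness.intrinsicRob μ fstar ε
        (IntrinsicRobustness.classwiseImperfect g fstar α) ≤
      ((1 + δ - ∑ i, p i * IntrinsicRobustness.gaussCDF
        (IntrinsicRobustness.gaussQuantile α + ((ε / ⨆ j, L j : ℝ) : EReal)) : ℝ) : EReal) := by
  obtain ⟨i₀⟩ : Nonempty (Fin K) := by
    by_contra hK
    have := not_nonempty_iff.1 hK
    simpa using hμ.sum_eq_one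
  have hL_le (i : Fin K) : L i ≤ ⨆ j, L j := le_ciSup (Set.finite_range L).bddAbove i
  have hL_pos : 0 < ⨆ j, L j :=
    (pos_of_mul_pos_right (hε.trans_le (hrL i₀)) hr.le).trans_le (hL_le i₀)
  have hadv {f : X → Fin K} (hf : Measurable f) :=
    hμ.sum_gaussShift_sub_le_advRisk (fun i ↦ (hL i).mono (hL_le i)) hL_pos hε
      ((hrL i₀).trans (mul_le_mul_of_nonneg_left (hL_le i₀) hr.le)) hfstar hf
  refine ⟨fun hp ↦ IntrinsicRobustness.intrinsicRob_le fun f ⟨hf, hrisk⟩ ↦ ?_,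
    IntrinsicRobustness.intrinsicRob_le fun f ⟨hf, hrisk⟩ ↦ ?_⟩
  · refine (sub_le_sub_right ?_ δ).trans (hadv hf)
    exact IntrinsicRobustness.iInf_mul_gaussShift_le_sum (div_pos hε hL_pos).le hα hp
      (fun i ↦ measureReal_nonneg) (hrisk.trans_eq (hμ.measureReal_eq _))
  · refine (sub_le_sub_right (Finset.sum_le_sum fun i _ ↦ ?_) δ).trans (hadv hf)
    exact mul_le_mul_of_nonneg_left (IntrinsicRobustness.gaussShift_mono _ (hrisk i)) (hμ.nonneg i)
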